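/- Let $(X_n)_{n\ge1}$ be i.i.d. $\mathbb Z$-valued random variables, $S_n=X_1+\dots+X_n$, let $0<\alpha\le2$, and suppose that $n^{-1/\alpha}S_n$ converges in distribution to a (non-degenerate) $\alpha$-stable law $F_\alpha$, that $E X_1=0$ if $\alpha>1$, and that the random walk $(S_n)$ is irreducible (every integer is reached with positive probability) and strongly aperiodic ($X_1$ is not supported in a coset of a proper subgroup of $\mathbb Z$). Let $(\xi(i))_{i\in\mathbb Z}$ be i.i.d. real random variables, independent of $(X_n)_{n\ge 1}$. Let $h:\mathbb R^2\to\mathbb R$ be measurable and symmetric with $E|h(\xi(1),\xi(2))|<\infty$, $E|h(\xi(1),\xi(1))|<\infty$ and $E\,h(\xi(1),\xi(2))=0$, and put $$h_1(x)=E\,h(x,\xi(1)),\qquad h_2(x,y)=h(x,y)-h_1(x)-h_1(y),\qquad R_n=\sum_{1\le i<j\le n}h_2(\xi(S_i),\xi(S_j)).$$ Let $1<\beta\le2$ and assume that $n^{-1/\beta}\sum_{i=1}^n h_1(\xi(i))$ converges in distribution to a (non-degenerate) $\beta$-stable law $F_\beta$, and that $E|h(\xi(1),\xi(2))|^\eta<\infty$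 with $\eta=\frac{2\beta'}{1+\beta'}$ for some $\beta'>\beta$. Then, with $\alpha'=\max(1,\alpha)$, almost surely $$\max_{k\le n}|R_k|=o\bigl(n^{2-\frac1{\alpha'}+\frac1{\alpha'\beta}}\bigr)\qquad(n\to\infty).$$ -/

import Mathlib

open MeasureTheory ProbabilityTheory Filter Asymptotics

noncomputable section

/-- `F` is an `α`-stable law on `ℝ`: it is not a point mass and, for independent copies
`Z₁, Z₂` of `Z ∼ F` and all `a, b > 0`, the variable `a Z₁ + b Z₂` has the same law as
`(a ^ α + b ^ α) ^ (1 / α) Z + c` for some real `c`. -/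
def IsStableLaw (α : ℝ) (F : Measure ℝ) : Prop :=
  IsProbabilityMeasure F ∧ (∀ c : ℝ, F ≠ Measure.dirac c) ∧
    ∀ a b : ℝ, 0 < a → 0 < b → ∃ c : ℝ,
      (F.map (fun x => a * x)).conv (F.map (fun x => b * x)) =
        F.map (fun x => (a ^ α + b ^ α) ^ (1 / α) * x + c)

/-- For an i.i.d. sequence `Y 0, Y 1, …` this says that its common law is in the normal domain of
attraction of `F` with index `α`: the variables `n ^ (-1 / α) (Y 0 + ⋯ + Y (n - 1))` converge in
distribution to `F`. -/
def NormallyAttracted {Ω : Type*} [MeasurableSpace Ω] (P : Measure Ω) [IsProbabilityMeasure P]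
    (Y : ℕ → Ω → ℝ) (α : ℝ) (F : Measure ℝ) [IsProbabilityMeasure F] : Prop :=
  TendstoInDistribution
    (fun (n : ℕ) (ω : Ω) => (n : ℝ) ^ (-(1 / α)) * ∑ m ∈ Finset.range n, Y m ω)
    atTop (id : ℝ → ℝ) (fun _ => P) F

/-- The random walk `S n` with steps `X 0, X 1, …`, started at `0`
(`X m` is the `(m + 1)`-st step). -/
def walk {Ω : Type*} (X : ℕ → Ω → ℤ) (n : ℕ) (ω : Ω) : ℤ :=
  ∑ m ∈ Finset.range n, X m ω

/-- The walk is irreducible: every integer is reached with positive probability. -/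
def WalkIrreducible {Ω : Type*} [MeasurableSpace Ω] (P : Measure Ω) (X : ℕ → Ω → ℤ) : Prop :=
  ∀ x : ℤ, ∃ n : ℕ, 0 < P {ω | walk X n ω = x}

/-- The walk is strongly aperiodic: its step is not supported in a coset of a proper subgroup
of `ℤ`. -/
def WalkStronglyAperiodic {Ω : Type*} [MeasurableSpace Ω] (P : Measure Ω) (X : ℕ → Ω → ℤ) : Prop :=
  ∀ (H : AddSubgroup ℤ) (x : ℤ), (∀ᵐ ω ∂P, X 0 ω - x ∈ H) → H = ⊤

/-- The first Hoeffding projection `h₁(x) = E h(x, ξ(1))` of a centred kernel. -/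
def hoeffding₁ {Ω : Type*} [MeasurableSpace Ω] (P : Measure Ω) (ξ : ℤ → Ω → ℝ)
    (h : ℝ → ℝ → ℝ) (x : ℝ) : ℝ :=
  ∫ ω, h x (ξ 1 ω) ∂P

/-- The degenerate kernel `h₂(x, y) = h(x, y) - h₁(x) - h₁(y)`. -/
def hoeffding₂ {Ω : Type*} [MeasurableSpace Ω] (P : Measure Ω) (ξ : ℤ → Ω → ℝ)
    (h : ℝ → ℝ → ℝ) (x y : ℝ) : ℝ :=
  h x y - hoeffding₁ P ξ h x - hoeffding₁ P ξ h y

/-- The Hoeffding remainder `R n = ∑_{1 ≤ i < j ≤ n} h₂(ξ(S i), ξ(S j))` of the `U`-statistic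
of the scenery `ξ` indexed by the walk with steps `X`. -/
def hoeffdingRemainder {Ω : Type*} [MeasurableSpace Ω] (P : Measure Ω) (X : ℕ → Ω → ℤ)
    (ξ : ℤ → Ω → ℝ) (h : ℝ → ℝ → ℝ) (n : ℕ) (ω : Ω) : ℝ :=
  ∑ j ∈ Finset.Icc 1 n, ∑ i ∈ Finset.Ico 1 j,
    hoeffding₂ P ξ h (ξ (walk X i ω) ω) (ξ (walk X j ω) ω)

end

/-!
Split the remainder `R n` into the pairs of times at which the walk visits distinct sites and
those at which it is at the same site. Given the walk, with local times `N(x)`, the first part is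
a quadratic form `∑ c x y h₂(ξ x, ξ y)` over `x ≠ y`, with coefficients that add up over disjoint
time blocks to at most `N(x) N(y)`. Since `h₂` is degenerate, the von Bahr–Esseen inequality,
applied once for each of the two variables, bounds its moment of order `η` by a constant times
`∑ c x y ^ η` (`DegenerateKernel.integral_quadratic_le`). As `∑ c x y ^ η` is superadditive over
time blocks, dyadic chaining in the style of Rademacher and Menshov controls the maximum over all
times up to `n` at the price of a power of `log n` (`abs_sum_rpow_le_dyadicEnergy`,
`integral_dyadicEnergy_le`), and the total is at most `(∑ N(x) ^ η) ^ 2`. The second part is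
dominated by `∑ N(x) ^ 2 |h₂(ξ x, ξ x)|`.

Both are governed by the number `V n = ∑ N(x) ^ 2` of self-intersections: interpolation gives
`(∑ N(x) ^ η) ^ 2 ≤ 4 n ^ 2 (V n / n) ^ (2 (η - 1))`, and `2 (η - 1) ≤ 1` once `β' ≤ 3`, which
costs nothing. So only `E (V n) = O(n ^ (2 - p))` for each `p < 1 / α'` is needed, that is
`P(S n = 0) = O(n ^ (-p))`. This follows by Fourier inversion from `|φ(t)| ≤ exp (-c |t| ^ α)` on
`[-π, π]` for the characteristic function `φ` of a step (`exists_norm_charFun_le_exp`); near `0`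
this bound is read off from the convergence in distribution, and away from `0` from strong
aperiodicity.

For `p` close to `1 / α'`, the resulting bound on the `η`-th moment at time `n` is smaller than
`n ^ (γ η)`, where `γ` is the exponent of the claim, by a power of `n`, because
`η > 2 β / (1 + β)`; this is where `β' > β` enters (`exists_exponent`). Summing over `n = 2 ^ L`
and Borel–Cantelli finish the proof.
-/

open MeasureTheory ProbabilityTheory Filter Asymptotics
open scoped Topology

/-! ### Characteristic functions and the return probabilities of the walk -/

section ReturnProbabilities

/-- Equality in `|E e^{itX}| ≤ 1` forces `e^{itX}` to be almost surely constant. -/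
lemma ae_cexp_eq_charFun {μ : Measure ℝ} [IsProbabilityMeasure μ] {t : ℝ}
    (ht : ‖charFun μ t‖ = 1) : ∀ᵐ x : ℝ ∂μ, Complex.exp (t * x * Complex.I) = charFun μ t := by
  set θ := charFun μ t with hθ
  have hint : Integrable (fun x : ℝ => Complex.exp (t * x * Complex.I)) μ := by
    refine Integrable.of_bound (C := 1) (by fun_prop) (ae_of_all _ fun x => ?_)
    rw [← Complex.ofReal_mul, Complex.norm_exp_ofReal_mul_I]
  have hθint : ∫ x : ℝ, Complex.exp (t * x * Complex.I) ∂μ = θ := by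
    rw [hθ, charFun_apply_real]
  have hconj : (starRingEnd ℂ) θ * θ = 1 := by
    rw [← Complex.normSq_eq_conj_mul_self, Complex.normSq_eq_norm_sq, ht]; simp
  have hn (x : ℝ) : ‖(starRingEnd ℂ) θ * Complex.exp (t * x * Complex.I)‖ = 1 := by
    rw [norm_mul, RCLike.norm_conj, ht, ← Complex.ofReal_mul, Complex.norm_exp_ofReal_mul_I,
      one_mul]
  have hint2 := hint.const_mul ((starRingEnd ℂ) θ)
  have h0 : ∫ x : ℝ, (1 - ((starRingEnd ℂ) θ * Complex.exp (t * x * Complex.I)).re) ∂μ = 0 := by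
    have hsub := integral_sub (integrable_const (μ := μ) (1 : ℝ)) hint2.re
    have : ∫ x : ℝ, ((starRingEnd ℂ) θ * Complex.exp (t * x * Complex.I)).re ∂μ
        = (∫ x : ℝ, (starRingEnd ℂ) θ * Complex.exp (t * x * Complex.I) ∂μ).re :=
      integral_re hint2
    rw [integral_const_mul, hθint, hconj] at this
    refine hsub.trans ?_
    erw [this]
    simp
  rw [integral_eq_zero_iff_of_nonneg
    (fun x => sub_nonneg.2 ((Complex.re_le_norm _).trans (hn x).le))
    ((integrable_const _).sub hint2.re)] at h0
  filter_upwards [h0] with x hx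
  have hre : ((starRingEnd ℂ) θ * Complex.exp (t * x * Complex.I)).re = 1 := by
    exact (sub_eq_zero.1 hx).symm
  have h1 : (starRingEnd ℂ) θ * Complex.exp (t * x * Complex.I) = 1 := by
    have h2 := Complex.sq_norm ((starRingEnd ℂ) θ * Complex.exp (t * x * Complex.I))
    rw [hn, Complex.normSq_apply, hre] at h2
    apply Complex.ext
    · simpa using hre
    · have : ((starRingEnd ℂ) θ * Complex.exp (t * x * Complex.I)).im *
        ((starRingEnd ℂ) θ * Complex.exp (t * x * Complex.I)).im = 0 := by linarith
      simpa using this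
  calc Complex.exp (t * x * Complex.I)
      = (θ * (starRingEnd ℂ) θ) * Complex.exp (t * x * Complex.I) := by
        rw [mul_comm θ, hconj, one_mul]
    _ = θ := by rw [mul_assoc, h1, mul_one]

lemma cexp_sub_eq_one {t x y : ℝ}
    (h : Complex.exp (t * x * Complex.I) = Complex.exp (t * y * Complex.I)) :
    ∃ m : ℤ, t * (x - y) = m * (2 * Real.pi) := by
  have h1 : Complex.exp (t * x * Complex.I - t * y * Complex.I) = 1 := by
    rw [Complex.exp_sub, h, div_self (Complex.exp_ne_zero _)]
  obtain ⟨m, hm⟩ := Complex.exp_eq_one_iff.1 h1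
  refine ⟨m, ?_⟩
  have h2 : ((t * (x - y) : ℝ) : ℂ) * Complex.I = ((m * (2 * Real.pi) : ℝ) : ℂ) * Complex.I := by
    push_cast
    rw [mul_sub, sub_mul, hm]; ring
  exact_mod_cast mul_right_cancel₀ Complex.I_ne_zero h2

lemma eq_zero_of_abs_lt {u : ℝ} (hu : |u| < 2 * Real.pi) {m : ℤ}
    (hm : u = m * (2 * Real.pi)) : u = 0 := by
  have hpi : 0 < 2 * Real.pi := by positivity
  rw [hm, abs_mul, abs_of_pos hpi] at hu
  have h1 : |(m : ℝ)| < 1 := by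
    by_contra hc
    push Not at hc
    nlinarith
  have h2 : m = 0 := by
    rw [← Int.abs_lt_one_iff]
    exact_mod_cast h1
  simp [hm, h2]

lemma exists_norm_charFun_lt_one {F : Measure ℝ} [IsProbabilityMeasure F]
    (hF : ∀ c : ℝ, F ≠ Measure.dirac c) : ∃ s : ℝ, 0 < s ∧ ‖charFun F s‖ < 1 := by
  by_contra! hcon
  have h1 : ∀ᵐ x : ℝ ∂F, ∀ n : ℕ, Complex.exp (((n + 1 : ℝ)⁻¹ : ℝ) * x * Complex.I)
      = charFun F ((n + 1 : ℝ)⁻¹ : ℝ) := by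
    rw [ae_all_iff]
    intro n
    exact ae_cexp_eq_charFun (le_antisymm (norm_charFun_le_one _) (hcon _ (by positivity)))
  obtain ⟨x₀, hx₀⟩ := h1.exists
  have h2 : (fun x : ℝ => x) =ᵐ[F] fun _ => x₀ := by
    filter_upwards [h1] with x hx
    -- at the argument `1 / (n + 1)` the phases of `x` and `x₀` differ by less than `2 π`
    obtain ⟨n, hn⟩ := exists_nat_gt |x - x₀|
    obtain ⟨m, hm⟩ := cexp_sub_eq_one ((hx n).trans (hx₀ n).symm)
    have hpos : (0 : ℝ) < n + 1 := by positivity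
    have h3 := eq_zero_of_abs_lt (u := ((n + 1 : ℝ)⁻¹ : ℝ) * (x - x₀)) (m := m) (by
      rw [abs_mul, abs_of_pos (by positivity : (0 : ℝ) < (n + 1 : ℝ)⁻¹), inv_mul_lt_iff₀ hpos]
      nlinarith [Real.pi_gt_three]) hm
    rcases mul_eq_zero.1 h3 with h | h
    · exact absurd h (by positivity)
    · linarith
  refine hF x₀ ?_
  have h4 : F.map (fun x : ℝ => x) = F.map fun _ => x₀ := Measure.map_congr h2
  rw [Measure.map_id', Measure.map_const, measure_univ, one_smul] at h4
  exact h4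

variable {Ω : Type*} [MeasurableSpace Ω] {P : Measure Ω}

lemma norm_charFun_lt_one_of_aperiodic [IsProbabilityMeasure P] {X : ℕ → Ω → ℤ}
    (hXm : ∀ n, Measurable (X n))
    (hX : WalkStronglyAperiodic P X) {t : ℝ} (ht0 : 0 < t) (ht : t < 2 * Real.pi) :
    ‖charFun (P.map fun ω => (X 0 ω : ℝ)) t‖ < 1 := by
  have hm : Measurable fun ω => (X 0 ω : ℝ) := by have := hXm 0; fun_prop
  have : IsProbabilityMeasure (P.map fun ω => (X 0 ω : ℝ)) :=
    Measure.isProbabilityMeasure_map hm.aemeasurable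
  refine lt_of_le_of_ne (norm_charFun_le_one _) fun h => ?_
  have h1 := ae_of_ae_map hm.aemeasurable (ae_cexp_eq_charFun h)
  obtain ⟨ω₀, h₀⟩ := h1.exists
  -- `X 0 - x` takes its values in the subgroup of the periods of `k ↦ e^{itk}`
  let H : AddSubgroup ℤ :=
    { carrier := {k | ∃ m : ℤ, t * k = m * (2 * Real.pi)}
      zero_mem' := ⟨0, by simp⟩
      add_mem' := by
        rintro a b ⟨m, hm⟩ ⟨n, hn⟩
        exact ⟨m + n, by push_cast; linarith⟩
      neg_mem' := by
        rintro a ⟨m, hm⟩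
        exact ⟨-m, by push_cast; linarith⟩ }
  have hH : H = ⊤ := by
    refine hX H (X 0 ω₀) ?_
    filter_upwards [h1] with ω hω
    obtain ⟨m, hm⟩ := cexp_sub_eq_one (hω.trans h₀.symm)
    exact ⟨m, by push_cast; exact hm⟩
  have h1 : (1 : ℤ) ∈ H := by rw [hH]; trivial
  obtain ⟨m, hm⟩ := h1
  have := eq_zero_of_abs_lt (u := t) (m := m) (by rwa [abs_of_pos ht0]) (by simpa using hm)
  exact ht0.ne' this

lemma charFun_map_sum_eq_pow {X : ℕ → Ω → ℤ} (hXm : ∀ n, Measurable (X n))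
    (hXindep : iIndepFun X P) (hXid : ∀ n, IdentDistrib (X n) (X 0) P P) (s : Finset ℕ) (t : ℝ) :
    charFun (P.map fun ω => ∑ m ∈ s, (X m ω : ℝ)) t
      = charFun (P.map fun ω => (X 0 ω : ℝ)) t ^ s.card := by
  have hm (n : ℕ) : Measurable fun ω => (X n ω : ℝ) := by have := hXm n; fun_prop
  have hind : iIndepFun (fun n ω => (X n ω : ℝ)) P :=
    hXindep.comp (fun _ z => (z : ℝ)) fun _ => measurable_of_countable _
  rw [iIndepFun.charFun_map_fun_finsetSum_eq_prod (fun i _ => (hm i).aemeasurable)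
    (hind.restrict s)]
  have hid (n : ℕ) : P.map (fun ω => (X n ω : ℝ)) = P.map fun ω => (X 0 ω : ℝ) :=
    ((hXid n).comp (u := fun z : ℤ => (z : ℝ)) (measurable_of_countable _)).map_eq
  simp [hid]

/-- Convergence of the characteristic functions of `n ^ (-1 / α) S n` at arguments that vary with
`n`: scaling by `s i → s₀` preserves convergence in distribution by Slutsky's theorem. -/
lemma tendsto_norm_charFun_pow [IsProbabilityMeasure P] {X : ℕ → Ω → ℤ}
    (hXm : ∀ n, Measurable (X n))
    (hXindep : iIndepFun X P) (hXid : ∀ n, IdentDistrib (X n) (X 0) P P)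
    {α : ℝ} {F : Measure ℝ} [IsProbabilityMeasure F]
    (hX : NormallyAttracted P (fun n ω => (X n ω : ℝ)) α F)
    {ι : Type*} {l : Filter ι} [l.IsCountablyGenerated] {n : ι → ℕ} {s : ι → ℝ} {s₀ : ℝ}
    (hn : Tendsto n l atTop) (hs : Tendsto s l (𝓝 s₀)) :
    Tendsto (fun i => ‖charFun (P.map fun ω => (X 0 ω : ℝ)) ((n i : ℝ) ^ (-(1 / α)) * s i)‖ ^ n i)
      l (𝓝 ‖charFun F s₀‖) := by
  have hm (n : ℕ) : Measurable fun ω => (X n ω : ℝ) := by have := hXm n; fun_prop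
  have h1 : TendstoInDistribution
      (fun i ω => (n i : ℝ) ^ (-(1 / α)) * ∑ m ∈ Finset.range (n i), (X m ω : ℝ)) l
      (id : ℝ → ℝ) (fun _ => P) F :=
    { forall_aemeasurable := fun i => hX.forall_aemeasurable (n i)
      aemeasurable_limit := hX.aemeasurable_limit
      tendsto := hX.tendsto.comp hn }
  have h2 := h1.continuous_comp_prodMk_of_tendstoInMeasure_const
    (g := fun x : ℝ × ℝ => x.2 * x.1) (by fun_prop) (Y := fun i _ => s i) (c := s₀)
    (by
      intro ε hε
      have : ∀ᶠ i in l, edist (s i) s₀ < ε := by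
        have := (tendsto_iff_edist_tendsto_0.1 hs).eventually (gt_mem_nhds hε)
        exact this
      refine tendsto_const_nhds.congr' ?_
      filter_upwards [this] with i hi
      simp [not_le.2 hi]) (by fun_prop)
  have h3 : Tendsto (fun i => charFun (P.map fun ω =>
      s i * ((n i : ℝ) ^ (-(1 / α)) * ∑ m ∈ Finset.range (n i), (X m ω : ℝ))) 1) l
      (𝓝 (charFun (F.map fun x => s₀ * x) 1)) := by
    simp_rw [charFun_eq_integral_innerProbChar]
    exact (ProbabilityMeasure.tendsto_iff_forall_integral_rclike_tendsto ℂ).1 h2.tendsto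
      (BoundedContinuousFunction.innerProbChar (1 : ℝ))
  rw [charFun_map_mul, mul_one] at h3
  refine h3.norm.congr fun i => ?_
  have h4 := charFun_map_sum_eq_pow hXm hXindep hXid (Finset.range (n i))
    ((n i : ℝ) ^ (-(1 / α)) * s i)
  rw [Finset.card_range] at h4
  rw [← norm_pow, ← h4]
  simp_rw [← mul_assoc]
  rw [charFun_map_mul_comp (by fun_prop), mul_one, mul_comm (s i)]

/-- Of the limit law only its non-degeneracy matters: `|E e^{i s₀ Z}| < 1` at some `s₀ > 0`. For
small `t` take `n = ⌈(s₀ / t) ^ α⌉`, so that `t n ^ (1 / α)` is close to `s₀` and `|φ(t)| ^ n`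
stays below some `q < 1`. -/
lemma exists_norm_charFun_le_exp_near_zero [IsProbabilityMeasure P] {X : ℕ → Ω → ℤ}
    (hXm : ∀ n, Measurable (X n))
    (hXindep : iIndepFun X P) (hXid : ∀ n, IdentDistrib (X n) (X 0) P P)
    {α : ℝ} (hα : 0 < α) {F : Measure ℝ} [IsProbabilityMeasure F]
    (hF : ∀ c : ℝ, F ≠ Measure.dirac c)
    (hX : NormallyAttracted P (fun n ω => (X n ω : ℝ)) α F) :
    ∃ c : ℝ, 0 < c ∧ ∃ δ : ℝ, 0 < δ ∧ ∀ t : ℝ, 0 < t → t < δ →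
      ‖charFun (P.map fun ω => (X 0 ω : ℝ)) t‖ ≤ Real.exp (-(c * t ^ α)) := by
  obtain ⟨s₀, hs₀, hlt⟩ := exists_norm_charFun_lt_one hF
  set φ : ℝ → ℂ := charFun (P.map fun ω => (X 0 ω : ℝ)) with hφ
  have hx : Tendsto (fun t : ℝ => (s₀ / t) ^ α) (𝓝[>] 0) atTop :=
    (tendsto_rpow_atTop hα).comp ((tendsto_inv_nhdsGT_zero.const_mul_atTop hs₀).congr fun t =>
      (div_eq_mul_inv s₀ t).symm)
  have hn : Tendsto (fun t : ℝ => ⌈(s₀ / t) ^ α⌉₊) (𝓝[>] 0) atTop :=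
    tendsto_nat_ceil_atTop.comp hx
  have hratio : Tendsto (fun t : ℝ => (⌈(s₀ / t) ^ α⌉₊ : ℝ) / (s₀ / t) ^ α) (𝓝[>] 0) (𝓝 1) :=
    tendsto_nat_ceil_div_atTop.comp hx
  have hs : Tendsto (fun t : ℝ => (⌈(s₀ / t) ^ α⌉₊ : ℝ) ^ (1 / α) * t) (𝓝[>] 0) (𝓝 s₀) := by
    have h1 := (hratio.rpow_const (p := 1 / α) (Or.inl one_ne_zero)).mul_const s₀
    rw [Real.one_rpow, one_mul] at h1
    refine h1.congr' ?_
    filter_upwards [self_mem_nhdsWithin] with t ht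
    have ht : 0 < t := ht
    have hq : 0 < s₀ / t := by positivity
    rw [Real.div_rpow (by positivity) (by positivity), ← Real.rpow_mul hq.le,
      mul_one_div_cancel hα.ne', Real.rpow_one]
    field_simp
  have hlim := tendsto_norm_charFun_pow hXm hXindep hXid hX hn hs
  -- any `q` strictly between the limit and `1`
  set q : ℝ := (1 + ‖charFun F s₀‖) / 2 with hq
  have hq0 : 0 < q := by positivity
  have hq1 : q < 1 := by rw [hq]; linarith
  have hev := (hlim.eventually_lt_const (show ‖charFun F s₀‖ < q by rw [hq]; linarith)).and
    (hratio.eventually_lt_const (show (1 : ℝ) < 2 by norm_num))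
  obtain ⟨δ, hδ, hδ'⟩ := mem_nhdsGT_iff_exists_Ioo_subset.1 hev
  have hlog : 0 < -Real.log q := by have := Real.log_neg hq0 hq1; linarith
  refine ⟨-Real.log q / (2 * s₀ ^ α), by positivity, δ, hδ, fun t ht htδ => ?_⟩
  obtain ⟨h1, h2⟩ := hδ' ⟨ht, htδ⟩
  set n : ℕ := ⌈(s₀ / t) ^ α⌉₊ with hndef
  have hn0 : 0 < n := Nat.ceil_pos.2 (by positivity)
  have hn0' : (0 : ℝ) < n := by exact_mod_cast hn0
  have harg : (n : ℝ) ^ (-(1 / α)) * ((n : ℝ) ^ (1 / α) * t) = t := by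
    rw [← mul_assoc, ← Real.rpow_add hn0']
    simp
  rw [harg] at h1
  rw [div_lt_iff₀ (by positivity), Real.div_rpow hs₀.le ht.le] at h2
  have htα : 0 < t ^ α := by positivity
  have hsα : 0 < s₀ ^ α := by positivity
  rcases (norm_nonneg (φ t)).eq_or_lt with h0 | h0
  · rw [← h0]; positivity
  rw [← Real.log_le_iff_le_exp h0]
  have h3 : n * Real.log ‖φ t‖ ≤ Real.log q := by
    rw [← Real.log_pow]
    exact Real.log_le_log (by positivity) h1.le
  have h4 : n * t ^ α ≤ 2 * s₀ ^ α := by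
    have := mul_le_mul_of_nonneg_right h2.le htα.le
    rwa [mul_assoc, div_mul_cancel₀ _ htα.ne'] at this
  have h5 : Real.log ‖φ t‖ ≤ -(-Real.log q / n) := by
    rw [neg_div, neg_neg, le_div_iff₀ hn0']; linarith
  refine h5.trans (neg_le_neg ?_)
  rw [div_mul_eq_mul_div, div_le_div_iff₀ (by positivity) hn0']
  nlinarith

/-- The bound near `0` extends to `(0, π]` because strong aperiodicity gives `|φ| < 1` on the
compact remainder. -/
lemma exists_norm_charFun_le_exp [IsProbabilityMeasure P] {X : ℕ → Ω → ℤ}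
    (hXm : ∀ n, Measurable (X n))
    (hXindep : iIndepFun X P) (hXid : ∀ n, IdentDistrib (X n) (X 0) P P)
    (hXaper : WalkStronglyAperiodic P X)
    {α : ℝ} (hα : 0 < α) {F : Measure ℝ} [IsProbabilityMeasure F]
    (hF : ∀ c : ℝ, F ≠ Measure.dirac c)
    (hX : NormallyAttracted P (fun n ω => (X n ω : ℝ)) α F) :
    ∃ c : ℝ, 0 < c ∧ ∀ t : ℝ, 0 < t → t ≤ Real.pi →
      ‖charFun (P.map fun ω => (X 0 ω : ℝ)) t‖ ≤ Real.exp (-(c * t ^ α)) := by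
  obtain ⟨c, hc, δ, hδ, h⟩ := exists_norm_charFun_le_exp_near_zero hXm hXindep hXid hα hF hX
  set φ : ℝ → ℂ := charFun (P.map fun ω => (X 0 ω : ℝ)) with hφ
  have hpi := Real.pi_pos
  obtain ⟨q, hq0, hq1, hq⟩ : ∃ q : ℝ, 0 < q ∧ q < 1 ∧ ∀ t ∈ Set.Icc δ Real.pi, ‖φ t‖ ≤ q := by
    rcases (Set.Icc δ Real.pi).eq_empty_or_nonempty with he | hne
    · exact ⟨1 / 2, by norm_num, by norm_num, by simp [he]⟩
    have hm : Measurable fun ω => (X 0 ω : ℝ) := by have := hXm 0; fun_prop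
    have : IsProbabilityMeasure (P.map fun ω => (X 0 ω : ℝ)) :=
      Measure.isProbabilityMeasure_map hm.aemeasurable
    have hcont : Continuous φ := continuous_charFun
    obtain ⟨t₀, ht₀, hmax⟩ := isCompact_Icc.exists_isMaxOn hne hcont.norm.continuousOn
    have hlt : ‖φ t₀‖ < 1 := norm_charFun_lt_one_of_aperiodic hXm hXaper
      (hδ.trans_le ht₀.1) (by linarith [ht₀.2])
    exact ⟨(1 + ‖φ t₀‖) / 2, by positivity, by linarith,
      fun t ht => (hmax ht).trans (by show ‖φ t₀‖ ≤ _; linarith)⟩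
  have hlog : 0 < -Real.log q := by have := Real.log_neg hq0 hq1; linarith
  refine ⟨min c (-Real.log q / Real.pi ^ α), lt_min hc (by positivity), fun t ht htpi => ?_⟩
  have htα : 0 < t ^ α := by positivity
  by_cases htδ : t < δ
  · refine (h t ht htδ).trans (Real.exp_le_exp.2 (neg_le_neg ?_))
    exact mul_le_mul_of_nonneg_right (min_le_left _ _) htα.le
  · refine (hq t ⟨not_lt.1 htδ, htpi⟩).trans ?_
    rw [← Real.log_le_iff_le_exp hq0]
    have h1 : min c (-Real.log q / Real.pi ^ α) * t ^ α
        ≤ -Real.log q / Real.pi ^ α * Real.pi ^ α :=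
      mul_le_mul (min_le_right _ _) (Real.rpow_le_rpow ht.le htpi hα.le) htα.le (by positivity)
    rw [div_mul_cancel₀ _ (by positivity)] at h1
    linarith

lemma integral_cexp_int_mul (k : ℤ) :
    ∫ t in (-Real.pi)..Real.pi, Complex.exp (t * k * Complex.I)
      = if k = 0 then 2 * (Real.pi : ℂ) else 0 := by
  split_ifs with hk
  · simp [hk]; ring
  · have hc : (k : ℂ) * Complex.I ≠ 0 := by simp [hk]
    have := integral_exp_mul_complex (a := -Real.pi) (b := Real.pi) hc
    rw [show (fun t : ℝ => Complex.exp (t * k * Complex.I))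
      = fun t : ℝ => Complex.exp (k * Complex.I * t) by ext; ring_nf, this, div_eq_zero_iff]
    left
    rw [sub_eq_zero, Complex.exp_eq_exp_iff_exists_int]
    exact ⟨k, by push_cast; ring⟩

/-- Fourier inversion at `0` for an integer-valued variable, with absolute values inside. -/
lemma two_pi_mul_measureReal_eq_zero_le [IsProbabilityMeasure P] {Y : Ω → ℤ} (hY : Measurable Y) :
    2 * Real.pi * P.real {ω | Y ω = 0}
      ≤ ∫ t in (-Real.pi)..Real.pi, ‖charFun (P.map fun ω => (Y ω : ℝ)) t‖ := by
  have hYm : Measurable fun ω => (Y ω : ℝ) := by fun_prop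
  have hpi := Real.pi_pos
  have h1 : ∫ t in (-Real.pi)..Real.pi, charFun (P.map fun ω => (Y ω : ℝ)) t
      = ((2 * Real.pi * P.real {ω | Y ω = 0} : ℝ) : ℂ) := by
    have h2 (t : ℝ) : charFun (P.map fun ω => (Y ω : ℝ)) t
        = ∫ ω, Complex.exp (t * Y ω * Complex.I) ∂P := by
      rw [charFun_apply_real, integral_map hYm.aemeasurable (by fun_prop)]
      simp
    simp_rw [h2]
    rw [intervalIntegral_integral_swap]
    · have h3 (ω : Ω) : ∫ t in (-Real.pi)..Real.pi, Complex.exp (t * Y ω * Complex.I)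
          = {ω | Y ω = 0}.indicator (fun _ => 2 * (Real.pi : ℂ)) ω := by
        rw [integral_cexp_int_mul]; simp [Set.indicator]
      simp_rw [h3]
      rw [integral_indicator (show MeasurableSet {ω | Y ω = 0} from hY (measurableSet_singleton 0)),
        setIntegral_const]
      simp; ring
    · have : IsFiniteMeasure (volume.restrict (Set.uIoc (-Real.pi) Real.pi)) :=
        ⟨by simp [Set.uIoc]⟩
      refine Integrable.of_bound (C := 1) ?_ (ae_of_all _ fun x => ?_)
      · refine Measurable.aestronglyMeasurable ?_
        have : Measurable fun ω => ((Y ω : ℝ) : ℂ) := by fun_prop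
        have h4 : Measurable fun x : ℝ × Ω =>
            Complex.exp (x.1 * ((Y x.2 : ℝ) : ℂ) * Complex.I) := by fun_prop
        simpa [Function.uncurry_def] using h4
      · have := Complex.norm_exp_ofReal_mul_I (x.1 * Y x.2)
        push_cast at this
        exact this.le
  calc 2 * Real.pi * P.real {ω | Y ω = 0}
      = ‖∫ t in (-Real.pi)..Real.pi, charFun (P.map fun ω => (Y ω : ℝ)) t‖ := by
        rw [h1, Complex.norm_real, Real.norm_of_nonneg (by positivity)]
    _ ≤ _ := intervalIntegral.norm_integral_le_integral_norm (by linarith)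

lemma exp_neg_le_rpow_neg {u p : ℝ} (hu : 0 < u) (hp0 : 0 ≤ p) (hp1 : p ≤ 1) :
    Real.exp (-u) ≤ u ^ (-p) := by
  rw [Real.exp_neg, Real.rpow_neg hu.le]
  refine inv_anti₀ (by positivity) ?_
  calc u ^ p ≤ (1 + u) ^ p := Real.rpow_le_rpow hu.le (by linarith) hp0
    _ ≤ (1 + u) ^ (1 : ℝ) := Real.rpow_le_rpow_of_exponent_le (by linarith) hp1
    _ ≤ Real.exp u := by rw [Real.rpow_one, add_comm]; exact Real.add_one_le_exp u

/-- A local limit bound for every exponent `p < min 1 (1 / α)`: integrating `exp (-c n t ^ α)`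
over `(0, π]` after bounding it by `(c n t ^ α) ^ (-p)`, which is integrable as `α p < 1`. Partial
sums over a set `s` of steps cover the differences `S j - S i` at once. -/
lemma exists_measureReal_sum_eq_zero_le [IsProbabilityMeasure P] {X : ℕ → Ω → ℤ}
    (hXm : ∀ n, Measurable (X n))
    (hXindep : iIndepFun X P) (hXid : ∀ n, IdentDistrib (X n) (X 0) P P)
    (hXaper : WalkStronglyAperiodic P X)
    {α : ℝ} (hα : 0 < α) {F : Measure ℝ} [IsProbabilityMeasure F]
    (hF : ∀ c : ℝ, F ≠ Measure.dirac c)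
    (hX : NormallyAttracted P (fun n ω => (X n ω : ℝ)) α F)
    {p : ℝ} (hp0 : 0 < p) (hp1 : p < 1) (hpα : α * p < 1) :
    ∃ C : ℝ, 0 ≤ C ∧ ∀ s : Finset ℕ, s.Nonempty →
      P.real {ω | ∑ m ∈ s, X m ω = 0} ≤ C * (s.card : ℝ) ^ (-p) := by
  obtain ⟨c, hc, h⟩ := exists_norm_charFun_le_exp hXm hXindep hXid hXaper hα hF hX
  set φ : ℝ → ℂ := charFun (P.map fun ω => (X 0 ω : ℝ)) with hφ
  have hpi := Real.pi_pos
  have hm : Measurable fun ω => (X 0 ω : ℝ) := by have := hXm 0; fun_prop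
  have : IsProbabilityMeasure (P.map fun ω => (X 0 ω : ℝ)) :=
    Measure.isProbabilityMeasure_map hm.aemeasurable
  have hcont : Continuous φ := continuous_charFun
  have hJ : 0 ≤ ∫ t in (0 : ℝ)..Real.pi, t ^ (-(α * p)) :=
    intervalIntegral.integral_nonneg hpi.le fun t ht => Real.rpow_nonneg ht.1 _
  refine ⟨c ^ (-p) * (∫ t in (0 : ℝ)..Real.pi, t ^ (-(α * p))) / Real.pi, by positivity,
    fun s hs => ?_⟩
  have hcard : (0 : ℝ) < s.card := by exact_mod_cast hs.card_pos
  have hYm : Measurable fun ω => ∑ m ∈ s, X m ω := Finset.measurable_fun_sum _ fun m _ => hXm m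
  have h1 := two_pi_mul_measureReal_eq_zero_le (P := P) hYm
  have h2 : (fun t => ‖charFun (P.map fun ω => ((∑ m ∈ s, X m ω : ℤ) : ℝ)) t‖)
      = fun t => ‖φ t‖ ^ s.card := by
    ext t
    push_cast
    rw [charFun_map_sum_eq_pow hXm hXindep hXid, norm_pow]
  rw [h2] at h1
  have hint (a b : ℝ) : IntervalIntegrable (fun t => ‖φ t‖ ^ s.card) volume a b :=
    (hcont.norm.pow _).intervalIntegrable _ _
  have h3 : ∫ t in (-Real.pi)..Real.pi, ‖φ t‖ ^ s.card
      = 2 * ∫ t in (0 : ℝ)..Real.pi, ‖φ t‖ ^ s.card := by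
    rw [← intervalIntegral.integral_add_adjacent_intervals (hint (-Real.pi) 0) (hint 0 Real.pi)]
    have := intervalIntegral.integral_comp_neg (a := 0) (b := Real.pi)
      (fun t => ‖φ t‖ ^ s.card)
    rw [neg_zero] at this
    rw [← this, two_mul]
    congr 1
    refine intervalIntegral.integral_congr fun t _ => ?_
    simp [hφ, charFun_neg]
  have h4 : ∫ t in (0 : ℝ)..Real.pi, ‖φ t‖ ^ s.card
      ≤ ∫ t in (0 : ℝ)..Real.pi, c ^ (-p) * (s.card : ℝ) ^ (-p) * t ^ (-(α * p)) := by
    refine intervalIntegral.integral_mono_on_of_le_Ioo hpi.le (hint _ _)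
      ((intervalIntegral.intervalIntegrable_rpow' (by linarith)).const_mul _) fun t ht => ?_
    have ht0 : 0 < t := ht.1
    calc ‖φ t‖ ^ s.card ≤ Real.exp (-(c * t ^ α)) ^ s.card :=
          pow_le_pow_left₀ (norm_nonneg _) (h t ht0 ht.2.le) _
      _ = Real.exp (-(c * s.card * t ^ α)) := by
          rw [← Real.exp_nat_mul]; ring_nf
      _ ≤ (c * s.card * t ^ α) ^ (-p) := exp_neg_le_rpow_neg (by positivity) hp0.le hp1.le
      _ = _ := by
          rw [Real.mul_rpow (by positivity) (by positivity),
            Real.mul_rpow (by positivity) (by positivity), ← Real.rpow_mul ht0.le, mul_neg]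
  rw [intervalIntegral.integral_const_mul] at h4
  rw [h3] at h1
  rw [div_mul_eq_mul_div, le_div_iff₀ hpi]
  nlinarith

end ReturnProbabilities

/-! ### The von Bahr–Esseen inequality and degenerate quadratic forms -/

section VonBahrEsseen

lemma two_rpow_le_four {η : ℝ} (h : η ≤ 2) : (2 : ℝ) ^ η ≤ 4 :=
  (Real.rpow_le_rpow_of_exponent_le (by norm_num) h).trans_eq (by norm_num)

lemma abs_one_add_rpow_le {η : ℝ} (h1 : 1 ≤ η) (h2 : η ≤ 2) (t : ℝ) :
    |1 + t| ^ η ≤ 1 + η * t + 4 * |t| ^ η := by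
  have hη : 0 ≤ η := by linarith
  rcases lt_or_ge t (-1) with ht | ht
  · have h3 : |1 + t| ≤ |t| := by
      rw [abs_of_neg (by linarith), abs_of_neg (by linarith)]; linarith
    have h4 : |1 + t| ^ η ≤ |t| ^ η := Real.rpow_le_rpow (abs_nonneg _) h3 hη
    have h5 : |t| ≤ |t| ^ η := by
      conv_lhs => rw [← Real.rpow_one |t|]
      exact Real.rpow_le_rpow_of_exponent_le (by rw [abs_of_neg (by linarith)]; linarith) h1
    rw [abs_of_neg (show t < 0 by linarith)] at *
    nlinarith
  rcases le_or_gt t 1 with ht' | ht'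
  · -- Bernoulli's inequality for the exponent `η - 1 ∈ [0, 1]`
    have h3 : (1 + t) ^ (η - 1) ≤ 1 + (η - 1) * t :=
      rpow_one_add_le_one_add_mul_self ht (by linarith) (by linarith)
    have h4 : |1 + t| ^ η = (1 + t) * (1 + t) ^ (η - 1) := by
      rw [abs_of_nonneg (by linarith)]
      rcases (show 0 ≤ 1 + t by linarith).eq_or_lt with h0 | h0
      · rw [← h0, Real.zero_rpow (by linarith)]; simp
      · rw [← Real.rpow_one_add' h0.le (by linarith)]; ring_nf
    have h5 : t ^ 2 ≤ |t| ^ η := by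
      rcases eq_or_ne t 0 with rfl | h0
      · simp [Real.zero_rpow (by linarith : η ≠ 0)]
      · rw [← sq_abs, ← Real.rpow_two]
        exact Real.rpow_le_rpow_of_exponent_ge (abs_pos.2 h0) (abs_le.2 ⟨ht, ht'⟩) h2
    rw [h4]
    nlinarith [mul_le_mul_of_nonneg_left h3 (show 0 ≤ 1 + t by linarith), sq_nonneg t]
  · have h3 : |1 + t| ^ η ≤ (2 * |t|) ^ η := Real.rpow_le_rpow (abs_nonneg _) (by
      rw [abs_of_pos (by linarith), abs_of_pos (by linarith)]; linarith) hη
    rw [Real.mul_rpow (by norm_num) (abs_nonneg _)] at h3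
    have h4 := two_rpow_le_four h2
    have h5 : 0 ≤ |t| ^ η := by positivity
    nlinarith [mul_le_mul_of_nonneg_right h4 h5]

/-- The pointwise inequality behind von Bahr–Esseen. The linear term is written `|a| ^ η / a * b`,
which is `0` at `a = 0`, as it should be. -/
lemma abs_add_rpow_le {η : ℝ} (h1 : 1 ≤ η) (h2 : η ≤ 2) (a b : ℝ) :
    |a + b| ^ η ≤ |a| ^ η + η * (|a| ^ η / a * b) + 4 * |b| ^ η := by
  rcases eq_or_ne a 0 with rfl | ha
  · have : 0 ≤ |b| ^ η := by positivity
    simp [Real.zero_rpow (by linarith : η ≠ 0)]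
    linarith
  · have h := mul_le_mul_of_nonneg_left (abs_one_add_rpow_le h1 h2 (b / a))
      (show 0 ≤ |a| ^ η by positivity)
    rw [← Real.mul_rpow (abs_nonneg _) (abs_nonneg _), ← abs_mul,
      show a * (1 + b / a) = a + b by field_simp] at h
    refine h.trans_eq ?_
    have h3 : |a| ^ η * |b / a| ^ η = |b| ^ η := by
      rw [← Real.mul_rpow (abs_nonneg _) (abs_nonneg _), ← abs_mul, mul_div_cancel₀ _ ha]
    linear_combination 4 * h3

lemma abs_rpow_div_mul_le {η : ℝ} (h1 : 1 ≤ η) (a b : ℝ) :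
    |(|a| ^ η / a * b)| ≤ |a| ^ η + |b| ^ η := by
  have ha' : 0 ≤ |a| ^ η := by positivity
  have hb' : 0 ≤ |b| ^ η := by positivity
  rcases eq_or_ne a 0 with rfl | ha
  · simp only [div_zero, zero_mul, abs_zero]; positivity
  have hapos := abs_pos.2 ha
  rw [abs_mul, abs_div, abs_of_nonneg ha']
  rcases le_total |b| |a| with h | h
  · have : |a| ^ η / |a| * |b| ≤ |a| ^ η / |a| * |a| := by gcongr
    rw [div_mul_cancel₀ _ hapos.ne'] at this
    linarith
  · have h3 : |a| ^ η / |a| = |a| ^ (η - 1) := (Real.rpow_sub_one hapos.ne' η).symm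
    have hbpos : 0 < |b| := hapos.trans_le h
    have h4 : |a| ^ (η - 1) * |b| ≤ |b| ^ (η - 1) * |b| := by
      gcongr
    rw [Real.rpow_sub_one hbpos.ne', div_mul_cancel₀ _ hbpos.ne'] at h4
    rw [h3]; linarith

/-- The family `ξ` with the coordinates outside `s` replaced by `0`. It carries the same
information as the restriction to `s`, and keeps functions of `(ξ i)_{i ∈ s}` free of subtypes. -/
def maskOutside {ι Ω : Type*} [DecidableEq ι] (ξ : ι → Ω → ℝ) (s : Finset ι) (ω : Ω) : ι → ℝ :=
  fun i => if i ∈ s then ξ i ω else 0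

lemma maskOutside_of_mem {ι Ω : Type*} [DecidableEq ι] (ξ : ι → Ω → ℝ) {s : Finset ι} {i : ι}
    (hi : i ∈ s) (ω : Ω) :
    maskOutside ξ s ω i = ξ i ω := if_pos hi

variable {Ω : Type*} [MeasurableSpace Ω] {P : Measure Ω}

/-- Fubini for independent variables: an integrand centred in the second variable has mean zero.
-/
lemma integral_eq_zero_of_indepFun [IsProbabilityMeasure P] {𝓤 𝓥 : Type*} [MeasurableSpace 𝓤]
    [MeasurableSpace 𝓥] {U : Ω → 𝓤} {V : Ω → 𝓥} (hU : Measurable U) (hV : Measurable V)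
    (hUV : IndepFun U V P) {G : 𝓤 → 𝓥 → ℝ} (hG : Measurable (Function.uncurry G))
    (hint : Integrable (fun ω => G (U ω) (V ω)) P)
    (h0 : ∀ᵐ ω ∂P, ∫ v, G (U ω) v ∂(P.map V) = 0) :
    ∫ ω, G (U ω) (V ω) ∂P = 0 := by
  have : IsProbabilityMeasure (P.map V) := Measure.isProbabilityMeasure_map hV.aemeasurable
  have : IsProbabilityMeasure (P.map U) := Measure.isProbabilityMeasure_map hU.aemeasurable
  have hmap := (indepFun_iff_map_prod_eq_prod_map_map hU.aemeasurable hV.aemeasurable).1 hUV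
  have hUVm : AEMeasurable (fun ω => (U ω, V ω)) P := (hU.prodMk hV).aemeasurable
  have h1 : ∫ ω, G (U ω) (V ω) ∂P = ∫ z, Function.uncurry G z ∂((P.map U).prod (P.map V)) := by
    rw [← hmap, integral_map hUVm hG.aestronglyMeasurable]
    rfl
  have h2 : Integrable (Function.uncurry G) ((P.map U).prod (P.map V)) := by
    rw [← hmap, integrable_map_measure hG.aestronglyMeasurable hUVm]
    exact hint
  rw [h1, integral_prod _ h2,
    integral_map hU.aemeasurable h2.aestronglyMeasurable.integral_prod_right']
  exact integral_eq_zero_of_ae h0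

/-- One step of the von Bahr–Esseen inequality: adding a conditionally centred increment to `f U`
costs at most four times its own moment of order `η`. -/
lemma integral_abs_add_rpow_le [IsProbabilityMeasure P] {𝓤 𝓥 : Type*} [MeasurableSpace 𝓤]
    [MeasurableSpace 𝓥] {U : Ω → 𝓤} {V : Ω → 𝓥} (hU : Measurable U) (hV : Measurable V)
    (hUV : IndepFun U V P) {η : ℝ} (h1 : 1 ≤ η) (h2 : η ≤ 2) {f : 𝓤 → ℝ} {g : 𝓤 → 𝓥 → ℝ}
    (hf : Measurable f) (hg : Measurable (Function.uncurry g))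
    (hfi : Integrable (fun ω => |f (U ω)| ^ η) P)
    (hgi : Integrable (fun ω => |g (U ω) (V ω)| ^ η) P)
    (h0 : ∀ᵐ ω ∂P, ∫ v, g (U ω) v ∂(P.map V) = 0) :
    Integrable (fun ω => |f (U ω) + g (U ω) (V ω)| ^ η) P ∧
      ∫ ω, |f (U ω) + g (U ω) (V ω)| ^ η ∂P
        ≤ ∫ ω, |f (U ω)| ^ η ∂P + 4 * ∫ ω, |g (U ω) (V ω)| ^ η ∂P := by
  have hgUV : Measurable fun ω => g (U ω) (V ω) := hg.comp (hU.prodMk hV)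
  have hfU : Measurable fun ω => f (U ω) := hf.comp hU
  have hcm : Measurable (Function.uncurry fun u v => |f u| ^ η / f u * g u v) := by
    have h3 : Measurable fun z : 𝓤 × 𝓥 => f z.1 := hf.comp measurable_fst
    exact ((h3.abs.pow_const η).div h3).mul hg
  have hci : Integrable (fun ω => |f (U ω)| ^ η / f (U ω) * g (U ω) (V ω)) P := by
    refine (hfi.add hgi).mono' (hcm.comp (hU.prodMk hV)).aestronglyMeasurable
      (ae_of_all _ fun ω => ?_)
    exact abs_rpow_div_mul_le h1 _ _
  have hc0 : ∫ ω, |f (U ω)| ^ η / f (U ω) * g (U ω) (V ω) ∂P = 0 := by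
    refine integral_eq_zero_of_indepFun hU hV hUV
      (G := fun u v => |f u| ^ η / f u * g u v) hcm hci ?_
    filter_upwards [h0] with ω hω
    rw [integral_const_mul, hω, mul_zero]
  have hdom : Integrable (fun ω => |f (U ω)| ^ η
      + η * (|f (U ω)| ^ η / f (U ω) * g (U ω) (V ω)) + 4 * |g (U ω) (V ω)| ^ η) P :=
    (hfi.add (hci.const_mul η)).add (hgi.const_mul 4)
  have hi : Integrable (fun ω => |f (U ω) + g (U ω) (V ω)| ^ η) P := by
    refine hdom.mono' ((hfU.add hgUV).abs.pow_const η).aestronglyMeasurable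
      (ae_of_all _ fun ω => ?_)
    rw [Real.norm_of_nonneg (by positivity)]
    exact abs_add_rpow_le h1 h2 _ _
  refine ⟨hi, (integral_mono hi hdom fun ω => abs_add_rpow_le h1 h2 _ _).trans_eq ?_⟩
  have e1 := integral_add (hfi.add (hci.const_mul η)) (hgi.const_mul 4)
  have e2 := integral_add hfi (hci.const_mul η)
  rw [integral_const_mul, hc0] at e2
  rw [integral_const_mul] at e1
  refine e1.trans ?_
  rw [add_left_inj]
  refine e2.trans ?_
  ring

section Sites

variable {ι : Type*}

lemma measurable_maskOutside [DecidableEq ι] {ξ : ι → Ω → ℝ} (hξ : ∀ i, Measurable (ξ i))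
    (s : Finset ι) :
    Measurable (maskOutside ξ s) := by
  refine measurable_pi_lambda _ fun i => ?_
  unfold maskOutside
  split_ifs
  · exact hξ i
  · exact measurable_const

lemma indepFun_maskOutside [DecidableEq ι] {ξ : ι → Ω → ℝ} (hξ : ∀ i, Measurable (ξ i))
    (hind : iIndepFun ξ P)
    {s : Finset ι} {z : ι} (hz : z ∉ s) : IndepFun (maskOutside ξ s) (ξ z) P := by
  have h := hind.indepFun_finset s {z} (Finset.disjoint_singleton_right.2 hz) hξ
  have hφ : Measurable fun (u : s → ℝ) (i : ι) => if h : i ∈ s then u ⟨i, h⟩ else 0 := by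
    refine measurable_pi_lambda _ fun i => ?_
    split_ifs
    · fun_prop
    · exact measurable_const
  have hψ : Measurable fun u : ({z} : Finset ι) → ℝ => u ⟨z, Finset.mem_singleton_self z⟩ := by
    fun_prop
  exact h.comp hφ hψ

lemma map_prodMk_eq_prod [IsProbabilityMeasure P] {ξ : ι → Ω → ℝ} (hξ : ∀ i, Measurable (ξ i))
    (hind : iIndepFun ξ P) {ν : Measure ℝ} (hν : ∀ i, P.map (ξ i) = ν) {x y : ι} (hxy : x ≠ y) :
    P.map (fun ω => (ξ x ω, ξ y ω)) = ν.prod ν := by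
  rw [(indepFun_iff_map_prod_eq_prod_map_map (hξ x).aemeasurable (hξ y).aemeasurable).1
    (hind.indepFun hxy), hν, hν]

lemma abs_add_rpow_le_four_mul {η : ℝ} (h1 : 1 ≤ η) (h2 : η ≤ 2) (a b : ℝ) :
    |a + b| ^ η ≤ 4 * (|a| ^ η + |b| ^ η) := by
  have h4 := two_rpow_le_four h2
  have ha : 0 ≤ |a| ^ η := by positivity
  have hb : 0 ≤ |b| ^ η := by positivity
  rcases le_total |a| |b| with h | h
  · have h3 : |a + b| ^ η ≤ (2 * |b|) ^ η :=
      Real.rpow_le_rpow (abs_nonneg _) (by linarith [abs_add_le a b]) (by linarith)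
    rw [Real.mul_rpow (by norm_num) (abs_nonneg _)] at h3
    nlinarith
  · have h3 : |a + b| ^ η ≤ (2 * |a|) ^ η :=
      Real.rpow_le_rpow (abs_nonneg _) (by linarith [abs_add_le a b]) (by linarith)
    rw [Real.mul_rpow (by norm_num) (abs_nonneg _)] at h3
    nlinarith

/-- `k` is a symmetric kernel with `E |k(ξ, ξ')| ^ η < ∞` and `E k(x, ξ) = 0` for almost every
`x`, where `ξ, ξ'` are independent of law `ν`. -/
structure DegenerateKernel (ν : Measure ℝ) (k : ℝ → ℝ → ℝ) (η : ℝ) : Prop where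
  measurable : Measurable (Function.uncurry k)
  symm : ∀ x y, k x y = k y x
  degenerate : ∀ᵐ x ∂ν, Integrable (k x) ν ∧ ∫ y, k x y ∂ν = 0
  moment : Integrable (fun z : ℝ × ℝ => |k z.1 z.2| ^ η) (ν.prod ν)

variable {ξ : ι → Ω → ℝ} {ν : Measure ℝ} {k : ℝ → ℝ → ℝ} {η : ℝ}

lemma DegenerateKernel.comp_measurable {α : Type*} [MeasurableSpace α]
    (hk : DegenerateKernel ν k η) {f g : α → ℝ} (hf : Measurable f) (hg : Measurable g) :
    Measurable fun a => k (f a) (g a) :=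
  hk.measurable.comp (hf.prodMk hg)

lemma DegenerateKernel.integrable_pair [IsProbabilityMeasure P] (hk : DegenerateKernel ν k η)
    (hξ : ∀ i, Measurable (ξ i)) (hind : iIndepFun ξ P) (hν : ∀ i, P.map (ξ i) = ν) {x y : ι}
    (hxy : x ≠ y) :
    Integrable (fun ω => |k (ξ x ω) (ξ y ω)| ^ η) P ∧
      ∫ ω, |k (ξ x ω) (ξ y ω)| ^ η ∂P = ∫ z, |k z.1 z.2| ^ η ∂(ν.prod ν) := by
  have hm : AEMeasurable (fun ω => (ξ x ω, ξ y ω)) P := ((hξ x).prodMk (hξ y)).aemeasurable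
  have h := hk.moment
  rw [← map_prodMk_eq_prod hξ hind hν hxy] at h ⊢
  exact ⟨(integrable_map_measure h.aestronglyMeasurable hm).1 h,
    (integral_map hm h.aestronglyMeasurable).symm⟩

lemma DegenerateKernel.ae_degenerate (hk : DegenerateKernel ν k η)
    (hξ : ∀ i, Measurable (ξ i)) (hν : ∀ i, P.map (ξ i) = ν) (x : ι) :
    ∀ᵐ ω ∂P, Integrable (k (ξ x ω)) ν ∧ ∫ y, k (ξ x ω) y ∂ν = 0 :=
  ae_of_ae_map (hξ x).aemeasurable (by rw [hν]; exact hk.degenerate)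

/-- For fixed `y`, the summands `b x k(ξ x, ξ y)` are centred and independent given `ξ y`; sites
are added one at a time. -/
lemma DegenerateKernel.integral_linear_le [DecidableEq ι] [IsProbabilityMeasure P]
    (hk : DegenerateKernel ν k η)
    (h1 : 1 ≤ η) (h2 : η ≤ 2)
    (hξ : ∀ i, Measurable (ξ i)) (hind : iIndepFun ξ P) (hν : ∀ i, P.map (ξ i) = ν)
    (b : ι → ℝ) {y : ι} {s : Finset ι} (hy : y ∉ s) :
    Integrable (fun ω => |∑ x ∈ s, b x * k (ξ x ω) (ξ y ω)| ^ η) P ∧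
      ∫ ω, |∑ x ∈ s, b x * k (ξ x ω) (ξ y ω)| ^ η ∂P
        ≤ 4 * (∫ z, |k z.1 z.2| ^ η ∂(ν.prod ν)) * ∑ x ∈ s, |b x| ^ η := by
  induction s using Finset.induction_on with
  | empty => simp [Real.zero_rpow (show η ≠ 0 by linarith)]
  | insert z s hz ih =>
    rw [Finset.mem_insert, not_or] at hy
    obtain ⟨ih1, ih2⟩ := ih hy.2
    obtain ⟨hzi, hzA⟩ := hk.integrable_pair hξ hind hν (Ne.symm hy.1)
    have hys : y ∈ insert y s := Finset.mem_insert_self y s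
    have hxs {x : ι} (hx : x ∈ s) : x ∈ insert y s := Finset.mem_insert_of_mem hx
    have hgi : Integrable (fun ω => |b z * k (ξ y ω) (ξ z ω)| ^ η) P := by
      simp_rw [abs_mul, Real.mul_rpow (abs_nonneg _) (abs_nonneg _), hk.symm (ξ y _)]
      exact hzi.const_mul _
    have hrw (ω : Ω) : ∑ x ∈ s, b x * k (maskOutside ξ (insert y s) ω x) (ξ y ω)
        = ∑ x ∈ s, b x * k (ξ x ω) (ξ y ω) :=
      Finset.sum_congr rfl fun x hx => by rw [maskOutside_of_mem ξ (hxs hx)]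
    have key := integral_abs_add_rpow_le (P := P) (measurable_maskOutside hξ (insert y s)) (hξ z)
      (indepFun_maskOutside hξ hind (s := insert y s) (by simp [hz, Ne.symm hy.1])) h1 h2
      (f := fun u => ∑ x ∈ s, b x * k (u x) (u y)) (g := fun u v => b z * k (u y) v)
      (Finset.measurable_fun_sum _ fun x _ => (hk.comp_measurable (by fun_prop)
        (by fun_prop)).const_mul _)
      ((hk.comp_measurable (by fun_prop) (by fun_prop)).const_mul _)
      (by simpa only [maskOutside_of_mem ξ hys, hrw] using ih1)
      (by simpa only [maskOutside_of_mem ξ hys] using hgi)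
      (by
        filter_upwards [hk.ae_degenerate hξ hν y] with ω hω
        rw [maskOutside_of_mem ξ hys, hν, integral_const_mul, hω.2, mul_zero])
    simp only [maskOutside_of_mem ξ hys, hrw] at key
    have hsum (ω : Ω) : ∑ x ∈ insert z s, b x * k (ξ x ω) (ξ y ω)
        = ∑ x ∈ s, b x * k (ξ x ω) (ξ y ω) + b z * k (ξ y ω) (ξ z ω) := by
      rw [Finset.sum_insert hz, add_comm, hk.symm (ξ z ω)]
    simp only [hsum]
    refine ⟨key.1, key.2.trans ?_⟩
    have h3 : ∫ ω, |b z * k (ξ y ω) (ξ z ω)| ^ η ∂P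
        = |b z| ^ η * ∫ z, |k z.1 z.2| ^ η ∂(ν.prod ν) := by
      simp_rw [abs_mul, Real.mul_rpow (abs_nonneg _) (abs_nonneg _), hk.symm (ξ y _)]
      rw [integral_const_mul, hzA]
    rw [h3, Finset.sum_insert hz]
    linarith

/-- Von Bahr–Esseen for degenerate quadratic forms. A new site `z` adds
`∑ (c x z + c z x) k(ξ x, ξ z)`, which is centred given the other sites; its own moment is bounded
by `integral_linear_le`. -/
lemma DegenerateKernel.integral_quadratic_le [DecidableEq ι] [IsProbabilityMeasure P]
    (hk : DegenerateKernel ν k η)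
    (h1 : 1 ≤ η) (h2 : η ≤ 2)
    (hξ : ∀ i, Measurable (ξ i)) (hind : iIndepFun ξ P) (hν : ∀ i, P.map (ξ i) = ν)
    (c : ι → ι → ℝ) (s : Finset ι) :
    Integrable (fun ω => |∑ x ∈ s, ∑ y ∈ s, if x = y then 0 else c x y * k (ξ x ω) (ξ y ω)| ^ η) P
      ∧ ∫ ω, |∑ x ∈ s, ∑ y ∈ s, if x = y then 0 else c x y * k (ξ x ω) (ξ y ω)| ^ η ∂P
        ≤ 64 * (∫ z, |k z.1 z.2| ^ η ∂(ν.prod ν)) * ∑ x ∈ s, ∑ y ∈ s, |c x y| ^ η := by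
  have hA : 0 ≤ ∫ z, |k z.1 z.2| ^ η ∂(ν.prod ν) := integral_nonneg fun z => by positivity
  induction s using Finset.induction_on with
  | empty => simp [Real.zero_rpow (show η ≠ 0 by linarith)]
  | insert z s hz ih =>
    obtain ⟨ih1, ih2⟩ := ih
    obtain ⟨hgi, hgA⟩ := hk.integral_linear_le h1 h2 hξ hind hν (fun x => c x z + c z x) hz
    have hmk (x y : ι) : Measurable fun u : ι → ℝ =>
        if x = y then 0 else c x y * k (u x) (u y) := by
      split_ifs
      · exact measurable_const
      · exact (hk.comp_measurable (by fun_prop) (by fun_prop)).const_mul _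
    have hf (ω : Ω) : (∑ x ∈ s, ∑ y ∈ s, if x = y then 0 else
        c x y * k (maskOutside ξ s ω x) (maskOutside ξ s ω y))
        = ∑ x ∈ s, ∑ y ∈ s, if x = y then 0 else c x y * k (ξ x ω) (ξ y ω) := by
      refine Finset.sum_congr rfl fun x hx => Finset.sum_congr rfl fun y hy => ?_
      rw [maskOutside_of_mem ξ hx, maskOutside_of_mem ξ hy]
    have hg (ω : Ω) (v : ℝ) : ∑ x ∈ s, (c x z + c z x) * k (maskOutside ξ s ω x) v
        = ∑ x ∈ s, (c x z + c z x) * k (ξ x ω) v :=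
      Finset.sum_congr rfl fun x hx => by rw [maskOutside_of_mem ξ hx]
    have key := integral_abs_add_rpow_le (P := P) (measurable_maskOutside hξ s) (hξ z)
      (indepFun_maskOutside hξ hind hz) h1 h2
      (f := fun u => ∑ x ∈ s, ∑ y ∈ s, if x = y then 0 else c x y * k (u x) (u y))
      (g := fun u v => ∑ x ∈ s, (c x z + c z x) * k (u x) v)
      (Finset.measurable_fun_sum _ fun x _ => Finset.measurable_fun_sum _ fun y _ => hmk x y)
      (Finset.measurable_fun_sum _ fun x _ => (hk.comp_measurable (by fun_prop)
        (by fun_prop)).const_mul _)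
      (by simpa only [hf] using ih1) (by simpa only [hg] using hgi)
      (by
        have hall : ∀ᵐ ω ∂P, ∀ x ∈ s, Integrable (k (ξ x ω)) ν ∧ ∫ y, k (ξ x ω) y ∂ν = 0 := by
          exact (ae_ball_iff s.countable_toSet).2 fun x _ => hk.ae_degenerate hξ hν x
        filter_upwards [hall] with ω hω
        simp only [hg, hν]
        rw [integral_finsetSum _ fun x hx => (hω x hx).1.const_mul _]
        refine Finset.sum_eq_zero fun x hx => ?_
        rw [integral_const_mul, (hω x hx).2, mul_zero])
    simp only [hf, hg] at key
    have hsum (ω : Ω) : (∑ x ∈ insert z s, ∑ y ∈ insert z s,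
          if x = y then 0 else c x y * k (ξ x ω) (ξ y ω))
        = (∑ x ∈ s, ∑ y ∈ s, if x = y then 0 else c x y * k (ξ x ω) (ξ y ω))
          + ∑ x ∈ s, (c x z + c z x) * k (ξ x ω) (ξ z ω) := by
      have e1 : (∑ y ∈ s, if z = y then 0 else c z y * k (ξ z ω) (ξ y ω))
          = ∑ x ∈ s, c z x * k (ξ x ω) (ξ z ω) :=
        Finset.sum_congr rfl fun x hx => by
          rw [if_neg (ne_of_mem_of_not_mem hx hz).symm, hk.symm]
      have e2 : (∑ x ∈ s, if x = z then 0 else c x z * k (ξ x ω) (ξ z ω))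
          = ∑ x ∈ s, c x z * k (ξ x ω) (ξ z ω) :=
        Finset.sum_congr rfl fun x hx => by rw [if_neg (ne_of_mem_of_not_mem hx hz)]
      simp only [Finset.sum_insert hz, if_true, zero_add, Finset.sum_add_distrib, add_mul, e1, e2]
      ring
    simp only [hsum]
    refine ⟨key.1, key.2.trans ?_⟩
    have h3 : ∑ x ∈ s, |c x z + c z x| ^ η ≤ 4 * (∑ x ∈ s, |c x z| ^ η + ∑ x ∈ s, |c z x| ^ η) := by
      rw [← Finset.sum_add_distrib, Finset.mul_sum]
      exact Finset.sum_le_sum fun x _ => abs_add_rpow_le_four_mul h1 h2 _ _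
    have h4 : ∑ x ∈ insert z s, ∑ y ∈ insert z s, |c x y| ^ η
        = |c z z| ^ η + (∑ x ∈ s, |c x z| ^ η + ∑ x ∈ s, |c z x| ^ η)
          + ∑ x ∈ s, ∑ y ∈ s, |c x y| ^ η := by
      simp only [Finset.sum_insert hz, Finset.sum_add_distrib]
      ring
    have h5 : 0 ≤ |c z z| ^ η := by positivity
    rw [h4]
    nlinarith [mul_le_mul_of_nonneg_left h3 hA, mul_nonneg hA h5]

end Sites

end VonBahrEsseen

/-! ### Chaining in time and local times -/

section Chaining

/-- The sum of `|∑ d j| ^ η`, `j` running over a dyadic block, over blocks inside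
`[a, a + 2 ^ L)`: the left halves of the dyadic intervals of length at least `2`, and all
singletons. These are the blocks needed to build up every initial segment. -/
noncomputable def dyadicEnergy (d : ℕ → ℝ) (η : ℝ) : ℕ → ℕ → ℝ
  | 0, a => |d a| ^ η
  | L + 1, a => |∑ j ∈ Finset.Ico a (a + 2 ^ L), d j| ^ η + dyadicEnergy d η L a
      + dyadicEnergy d η L (a + 2 ^ L)

lemma dyadicEnergy_nonneg (d : ℕ → ℝ) (η : ℝ) (L a : ℕ) : 0 ≤ dyadicEnergy d η L a := by
  induction L generalizing a with
  | zero => unfold dyadicEnergy; positivity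
  | succ L ih =>
    unfold dyadicEnergy
    have h1 := ih a
    have h2 := ih (a + 2 ^ L)
    positivity

/-- Convexity of `x ^ η` with the weights `1 / (L + 2)` and `(L + 1) / (L + 2)`, chosen so that
the constants telescope in the induction on scales. -/
lemma add_rpow_le_weighted {η : ℝ} (h1 : 1 ≤ η) (L : ℕ) {u v : ℝ} (hu : 0 ≤ u) (hv : 0 ≤ v) :
    (u + v) ^ η ≤ ((L : ℝ) + 2) ^ (η - 1) * (u ^ η + v ^ η / ((L : ℝ) + 1) ^ (η - 1)) := by
  have hL : (0 : ℝ) < (L : ℝ) + 1 := by positivity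
  have hL2 : (0 : ℝ) < (L : ℝ) + 2 := by positivity
  have h := (convexOn_rpow h1).2
    (show ((L : ℝ) + 2) * u ∈ Set.Ici 0 from Set.mem_Ici.2 (by positivity))
    (show ((L : ℝ) + 2) / (L + 1) * v ∈ Set.Ici 0 from Set.mem_Ici.2 (by positivity))
    (show 0 ≤ 1 / ((L : ℝ) + 2) by positivity)
    (show 0 ≤ ((L : ℝ) + 1) / (L + 2) by positivity) (by field_simp; ring)
  simp only [smul_eq_mul] at h
  rw [show 1 / ((L : ℝ) + 2) * ((L + 2) * u) + (L + 1) / (L + 2) * ((L + 2) / (L + 1) * v) = u + v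
    by field_simp] at h
  refine h.trans_eq ?_
  rw [Real.mul_rpow hL2.le hu, Real.mul_rpow (by positivity) hv, Real.div_rpow hL2.le hL.le,
    Real.rpow_sub_one hL2.ne', Real.rpow_sub_one hL.ne']
  field_simp

/-- Chaining: a segment longer than `2 ^ L` is a left half of length `2 ^ L` followed by an
initial segment of the right half. The loss is only a power of the number `L` of scales. -/
lemma abs_sum_rpow_le_dyadicEnergy (d : ℕ → ℝ) {η : ℝ} (h1 : 1 ≤ η) (L a m : ℕ) (hm : m ≤ 2 ^ L) :
    |∑ j ∈ Finset.Ico a (a + m), d j| ^ η ≤ ((L : ℝ) + 1) ^ (η - 1) * dyadicEnergy d η L a := by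
  induction L generalizing a m with
  | zero =>
    interval_cases m
    · simp [Real.zero_rpow (show η ≠ 0 by linarith)]
      exact dyadicEnergy_nonneg _ _ _ _
    · simp [dyadicEnergy]
  | succ L ih =>
    have hL : (0 : ℝ) < (L : ℝ) + 1 := by positivity
    have hle : ((L : ℝ) + 1) ^ (η - 1) ≤ ((L : ℝ) + 2) ^ (η - 1) :=
      Real.rpow_le_rpow hL.le (by linarith) (by linarith)
    have hq1 := dyadicEnergy_nonneg d η L a
    have hq2 := dyadicEnergy_nonneg d η L (a + 2 ^ L)
    have hS : 0 ≤ |∑ j ∈ Finset.Ico a (a + 2 ^ L), d j| ^ η := by positivity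
    push_cast
    rw [show (L : ℝ) + 1 + 1 = L + 2 by ring]
    unfold dyadicEnergy
    rcases le_or_gt m (2 ^ L) with h | h
    · refine (ih a m h).trans (mul_le_mul hle (by linarith) hq1 (by positivity))
    · obtain ⟨m', rfl⟩ := Nat.exists_eq_add_of_le h.le
      have h3 := ih (a + 2 ^ L) m' (by rw [pow_succ] at hm; omega)
      have h4 : ∑ j ∈ Finset.Ico a (a + (2 ^ L + m')), d j
          = ∑ j ∈ Finset.Ico a (a + 2 ^ L), d j
            + ∑ j ∈ Finset.Ico (a + 2 ^ L) (a + 2 ^ L + m'), d j := by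
        rw [Finset.sum_Ico_consecutive _ (by omega) (by omega), add_assoc]
      rw [h4]
      refine (Real.rpow_le_rpow (abs_nonneg _) (abs_add_le _ _) (by linarith)).trans
        ((add_rpow_le_weighted h1 L (abs_nonneg _) (abs_nonneg _)).trans ?_)
      refine mul_le_mul_of_nonneg_left ?_ (by positivity)
      have h5 := (div_le_iff₀' (show 0 < ((L : ℝ) + 1) ^ (η - 1) by positivity)).2 h3
      linarith

variable {Ω : Type*} [MeasurableSpace Ω] {P : Measure Ω}

/-- Expectation step of the Rademacher–Menshov inequality: blocks of one scale are disjoint, so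
that superadditivity of the bound `G` makes each scale cost at most `G` of the whole interval. -/
lemma integral_dyadicEnergy_le {d : ℕ → Ω → ℝ} {η : ℝ} {G : ℕ → ℕ → ℝ} {N : ℕ}
    (hG : ∀ a b, b ≤ N → Integrable (fun ω => |∑ j ∈ Finset.Ico a b, d j ω| ^ η) P ∧
      ∫ ω, |∑ j ∈ Finset.Ico a b, d j ω| ^ η ∂P ≤ G a b)
    (hsuper : ∀ a b c, a ≤ b → b ≤ c → G a b + G b c ≤ G a c) (L a : ℕ) (ha : a + 2 ^ L ≤ N) :
    Integrable (fun ω => dyadicEnergy (fun j => d j ω) η L a) P ∧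
      ∫ ω, dyadicEnergy (fun j => d j ω) η L a ∂P ≤ ((L : ℝ) + 1) * G a (a + 2 ^ L) := by
  induction L generalizing a with
  | zero => simpa [dyadicEnergy] using hG a (a + 1) (by simpa using ha)
  | succ L ih =>
    rw [pow_succ] at ha ⊢
    obtain ⟨i1, b1⟩ := ih a (by omega)
    obtain ⟨i2, b2⟩ := ih (a + 2 ^ L) (by omega)
    obtain ⟨i3, b3⟩ := hG a (a + 2 ^ L) (by omega)
    have e1 := integral_add (i3.add i1) i2
    have e2 := integral_add i3 i1
    simp only [Pi.add_apply] at e1 e2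
    unfold dyadicEnergy
    refine ⟨(i3.add i1).add i2, ?_⟩
    rw [e1, e2]
    have s1 := hsuper a (a + 2 ^ L) (a + 2 ^ L + 2 ^ L) (by omega) (by omega)
    have s2 : 0 ≤ G (a + 2 ^ L) (a + 2 ^ L + 2 ^ L) :=
      (integral_nonneg fun ω => by positivity).trans (hG _ _ (by omega)).2
    rw [show a + 2 ^ L * 2 = a + 2 ^ L + 2 ^ L by ring]
    push_cast
    nlinarith [mul_le_mul_of_nonneg_left s1 (show (0 : ℝ) ≤ (L : ℝ) + 1 by positivity)]

/-- The part of `∑_{1 ≤ i < j} k(z(w i), z(w j))` in which the path `w` visits distinct sites at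
the times `i` and `j`. -/
def offDiagTerm (k : ℝ → ℝ → ℝ) (w : ℕ → ℤ) (z : ℤ → ℝ) (j : ℕ) : ℝ :=
  ∑ i ∈ Finset.Ico 1 j, if w i = w j then 0 else k (z (w i)) (z (w j))

/-- The number of time pairs `1 ≤ i < j`, `a ≤ j < b`, with `w i = x` and `w j = y`. -/
def pairCount (w : ℕ → ℤ) (a b : ℕ) (x y : ℤ) : ℝ :=
  ∑ j ∈ Finset.Ico a b, ∑ i ∈ Finset.Ico 1 j, if w i = x ∧ w j = y then 1 else 0

/-- The number of visits of the path `w` to `x` at the times `0, …, N - 1`. -/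
def localTime (w : ℕ → ℤ) (N : ℕ) (x : ℤ) : ℝ :=
  ∑ i ∈ Finset.range N, if w i = x then 1 else 0

/-- The number of ordered pairs of times in `0, …, N - 1`, equal ones included, at which the path
`w` is at the same site; equivalently the sum of the squares of the local times. -/
def selfIntersections (w : ℕ → ℤ) (N : ℕ) : ℝ :=
  ∑ i ∈ Finset.range N, ∑ j ∈ Finset.range N, if w i = w j then 1 else 0

lemma pairCount_nonneg (w : ℕ → ℤ) (a b : ℕ) (x y : ℤ) : 0 ≤ pairCount w a b x y :=
  Finset.sum_nonneg fun _ _ => Finset.sum_nonneg fun _ _ => by split_ifs <;> norm_num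

lemma localTime_nonneg (w : ℕ → ℤ) (N : ℕ) (x : ℤ) : 0 ≤ localTime w N x :=
  Finset.sum_nonneg fun _ _ => by split_ifs <;> norm_num

lemma pairCount_add (w : ℕ → ℤ) {a b c : ℕ} (hab : a ≤ b) (hbc : b ≤ c) (x y : ℤ) :
    pairCount w a b x y + pairCount w b c x y = pairCount w a c x y :=
  Finset.sum_Ico_consecutive _ hab hbc

lemma pairCount_le (w : ℕ → ℤ) (N : ℕ) (x y : ℤ) :
    pairCount w 0 N x y ≤ localTime w N x * localTime w N y := by
  unfold pairCount localTime
  rw [mul_comm, Finset.sum_mul_sum, Finset.range_eq_Ico]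
  refine Finset.sum_le_sum fun j hj => ?_
  have hsub : Finset.Ico 1 j ⊆ Finset.Ico 0 N := by
    intro i hi
    simp only [Finset.mem_Ico] at hi hj ⊢
    omega
  refine (Finset.sum_le_sum_of_subset_of_nonneg hsub fun _ _ _ => by
    split_ifs <;> norm_num).trans (Finset.sum_le_sum fun i _ => ?_)
  split_ifs <;> simp_all

lemma sum_offDiagTerm_eq (k : ℝ → ℝ → ℝ) (w : ℕ → ℤ) (z : ℤ → ℝ) {a b N : ℕ} (hb : b ≤ N) :
    ∑ j ∈ Finset.Ico a b, offDiagTerm k w z j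
      = ∑ x ∈ (Finset.range N).image w, ∑ y ∈ (Finset.range N).image w,
          if x = y then 0 else pairCount w a b x y * k (z x) (z y) := by
  set s := (Finset.range N).image w with hs
  have hterm (i j : ℕ) (hi : w i ∈ s) (hj : w j ∈ s) :
      (if w i = w j then 0 else k (z (w i)) (z (w j)))
        = ∑ x ∈ s, ∑ y ∈ s, (if w i = x ∧ w j = y then 1 else 0)
            * (if x = y then 0 else k (z x) (z y)) := by
    rw [Finset.sum_eq_single_of_mem (w i) hi fun x _ hx =>
      Finset.sum_eq_zero fun y _ => by simp [Ne.symm hx],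
      Finset.sum_eq_single_of_mem (w j) hj fun y _ hy => by simp [Ne.symm hy]]
    simp
  calc ∑ j ∈ Finset.Ico a b, offDiagTerm k w z j
      = ∑ j ∈ Finset.Ico a b, ∑ i ∈ Finset.Ico 1 j, ∑ x ∈ s, ∑ y ∈ s,
          (if w i = x ∧ w j = y then 1 else 0) * (if x = y then 0 else k (z x) (z y)) := by
        refine Finset.sum_congr rfl fun j hj => Finset.sum_congr rfl fun i hi => ?_
        simp only [Finset.mem_Ico] at hi hj
        exact hterm i j (Finset.mem_image_of_mem _ (Finset.mem_range.2 (by omega)))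
          (Finset.mem_image_of_mem _ (Finset.mem_range.2 (by omega)))
    _ = ∑ x ∈ s, ∑ y ∈ s, ∑ j ∈ Finset.Ico a b, ∑ i ∈ Finset.Ico 1 j,
          (if w i = x ∧ w j = y then 1 else 0) * (if x = y then 0 else k (z x) (z y)) := by
        rw [Finset.sum_congr rfl fun j _ => Finset.sum_comm, Finset.sum_comm]
        refine Finset.sum_congr rfl fun x _ => ?_
        rw [Finset.sum_congr rfl fun j _ => Finset.sum_comm, Finset.sum_comm]
    _ = _ := by
        refine Finset.sum_congr rfl fun x _ => Finset.sum_congr rfl fun y _ => ?_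
        simp_rw [← Finset.sum_mul]
        split_ifs with h
        · simp
        · rfl

lemma sum_localTime (w : ℕ → ℤ) (N : ℕ) :
    ∑ x ∈ (Finset.range N).image w, localTime w N x = N := by
  unfold localTime
  rw [Finset.sum_comm]
  have h (i : ℕ) (hi : i ∈ Finset.range N) :
      ∑ x ∈ (Finset.range N).image w, (if w i = x then (1 : ℝ) else 0) = 1 := by
    rw [Finset.sum_ite_eq, if_pos (Finset.mem_image_of_mem _ hi)]
  rw [Finset.sum_congr rfl h]
  simp

lemma sum_localTime_sq (w : ℕ → ℤ) (N : ℕ) :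
    ∑ x ∈ (Finset.range N).image w, localTime w N x ^ 2 = selfIntersections w N := by
  unfold localTime selfIntersections
  simp_rw [sq, Finset.sum_mul_sum]
  rw [Finset.sum_comm]
  refine Finset.sum_congr rfl fun i hi => ?_
  rw [Finset.sum_comm]
  refine Finset.sum_congr rfl fun j hj => ?_
  rw [Finset.sum_eq_single_of_mem (w i) (Finset.mem_image_of_mem _ hi) fun x _ hx => by
    simp [Ne.symm hx]]
  simp [eq_comm]

lemma natCast_le_selfIntersections (w : ℕ → ℤ) (N : ℕ) : (N : ℝ) ≤ selfIntersections w N := by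
  unfold selfIntersections
  calc (N : ℝ) = ∑ i ∈ Finset.range N, (1 : ℝ) := by simp
    _ ≤ _ := Finset.sum_le_sum fun i hi => by
      have := Finset.single_le_sum (f := fun j => if w i = w j then (1 : ℝ) else 0)
        (fun j _ => by split_ifs <;> norm_num) hi
      simpa using this

/-- A linear upper bound for the concave power `x ^ r` with a free scale `B`; it replaces both
Hölder's and Jensen's inequality below. -/
lemma rpow_le_rpow_add_mul {r : ℝ} (h0 : 0 ≤ r) (h1 : r ≤ 1) {x B : ℝ} (hx : 0 ≤ x) (hB : 0 < B) :
    x ^ r ≤ B ^ r + B ^ (r - 1) * x := by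
  rcases le_or_gt x B with h | h
  · have := Real.rpow_le_rpow hx h h0
    have : 0 ≤ B ^ (r - 1) * x := by positivity
    linarith
  · have hx' : 0 < x := hB.trans h
    have h2 : x ^ (r - 1) ≤ B ^ (r - 1) := Real.rpow_le_rpow_of_nonpos hB h.le (by linarith)
    have h3 : x ^ r = x ^ (r - 1) * x := by
      rw [Real.rpow_sub_one hx'.ne', div_mul_cancel₀ _ hx'.ne']
    have : 0 ≤ B ^ r := by positivity
    nlinarith

/-- Interpolation of `∑ N(x) ^ η` between `∑ N(x)` and `∑ N(x) ^ 2`. -/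
lemma sum_localTime_rpow_le (w : ℕ → ℤ) {N : ℕ} (hN : 0 < N) {η : ℝ} (h1 : 1 ≤ η) (h2 : η ≤ 2) :
    ∑ x ∈ (Finset.range N).image w, localTime w N x ^ η
      ≤ 2 * N * (selfIntersections w N / N) ^ (η - 1) := by
  have hN' : (0 : ℝ) < N := by exact_mod_cast hN
  have hV : 0 < selfIntersections w N := hN'.trans_le (natCast_le_selfIntersections w N)
  set B := selfIntersections w N / N with hB
  have hBpos : 0 < B := by positivity
  -- the scale `B`, the mean of `N(x)` along the path, balances the two terms
  have hpt (x : ℤ) : localTime w N x ^ η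
      ≤ B ^ (η - 1) * localTime w N x + B ^ (η - 1 - 1) * localTime w N x ^ 2 := by
    have hn := localTime_nonneg w N x
    have h3 := mul_le_mul_of_nonneg_right
      (rpow_le_rpow_add_mul (r := η - 1) (by linarith) (by linarith) hn hBpos) hn
    have h4 : localTime w N x ^ (η - 1) * localTime w N x = localTime w N x ^ η := by
      rw [← Real.rpow_add_one' hn (by linarith)]; ring_nf
    rw [h4] at h3
    linarith
  refine (Finset.sum_le_sum fun x _ => hpt x).trans_eq ?_
  rw [Finset.sum_add_distrib, ← Finset.mul_sum, ← Finset.mul_sum, sum_localTime, sum_localTime_sq,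
    Real.rpow_sub_one hBpos.ne' (η - 1), show selfIntersections w N = B * N by
      rw [hB, div_mul_cancel₀ _ hN'.ne']]
  field_simp
  ring

/-- For a fixed path, the off-diagonal sum over a block of times is a quadratic form in the
scenery with coefficients `pairCount`. These are additive in the block, so that their powers of
order `η ≥ 1` are superadditive, and at most `N(x) N(y)` in total. -/
lemma DegenerateKernel.integral_dyadicEnergy_offDiag_le [IsProbabilityMeasure P]
    {ξ : ℤ → Ω → ℝ} {ν : Measure ℝ} {k : ℝ → ℝ → ℝ} {η : ℝ} (hk : DegenerateKernel ν k η)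
    (h1 : 1 ≤ η) (h2 : η ≤ 2)
    (hξ : ∀ i, Measurable (ξ i)) (hind : iIndepFun ξ P) (hν : ∀ i, P.map (ξ i) = ν)
    (w : ℕ → ℤ) (L : ℕ) :
    Integrable (fun ω => dyadicEnergy (offDiagTerm k w fun i => ξ i ω) η L 0) P ∧
      ∫ ω, dyadicEnergy (offDiagTerm k w fun i => ξ i ω) η L 0 ∂P
        ≤ ((L : ℝ) + 1) * (64 * (∫ z, |k z.1 z.2| ^ η ∂(ν.prod ν)) *
          (2 * (2 ^ L : ℕ) * (selfIntersections w (2 ^ L) / (2 ^ L : ℕ)) ^ (η - 1)) ^ 2) := by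
  have hA : 0 ≤ ∫ z, |k z.1 z.2| ^ η ∂(ν.prod ν) := integral_nonneg fun z => by positivity
  set N : ℕ := 2 ^ L with hN
  set s := (Finset.range N).image w with hs
  have key := integral_dyadicEnergy_le (P := P) (η := η) (N := N)
    (d := fun j ω => offDiagTerm k w (fun i => ξ i ω) j)
    (G := fun a b => 64 * (∫ z, |k z.1 z.2| ^ η ∂(ν.prod ν)) *
      ∑ x ∈ s, ∑ y ∈ s, |pairCount w a b x y| ^ η)
    (fun a b hb => by
      simp_rw [sum_offDiagTerm_eq k w _ hb]
      exact hk.integral_quadratic_le h1 h2 hξ hind hν (pairCount w a b) s)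
    (fun a b c hab hbc => by
      rw [← mul_add, ← Finset.sum_add_distrib]
      simp_rw [← Finset.sum_add_distrib]
      gcongr with x _ y _
      rw [← pairCount_add w hab hbc, abs_of_nonneg (pairCount_nonneg ..),
        abs_of_nonneg (pairCount_nonneg ..),
        abs_of_nonneg (add_nonneg (pairCount_nonneg ..) (pairCount_nonneg ..))]
      exact Real.add_rpow_le_rpow_add (pairCount_nonneg ..) (pairCount_nonneg ..) h1)
    L 0 (by omega)
  refine ⟨key.1, key.2.trans ?_⟩
  rw [zero_add, ← hN]
  gcongr
  calc ∑ x ∈ s, ∑ y ∈ s, |pairCount w 0 N x y| ^ η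
      ≤ ∑ x ∈ s, ∑ y ∈ s, localTime w N x ^ η * localTime w N y ^ η := by
        gcongr with x _ y _
        rw [abs_of_nonneg (pairCount_nonneg ..),
          ← Real.mul_rpow (localTime_nonneg ..) (localTime_nonneg ..)]
        exact Real.rpow_le_rpow (pairCount_nonneg ..) (pairCount_le ..) (by linarith)
    _ = (∑ x ∈ s, localTime w N x ^ η) ^ 2 := by rw [sq, Finset.sum_mul_sum]
    _ ≤ _ := by
        refine pow_le_pow_left₀ (Finset.sum_nonneg fun x _ =>
          Real.rpow_nonneg (localTime_nonneg ..) _) ?_ 2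
        exact sum_localTime_rpow_le w (by positivity) h1 h2

end Chaining

/-! ### Self-intersections of the walk, and conditioning on it -/

section SelfIntersections

lemma sum_range_rpow_neg_le {p : ℝ} (hp0 : 0 < p) (hp1 : p < 1) (N : ℕ) :
    ∑ m ∈ Finset.range N, ((m : ℝ) + 1) ^ (-p) ≤ (N : ℝ) ^ (1 - p) / (1 - p) := by
  have hq : 0 < 1 - p := by linarith
  induction N with
  | zero => simp [Real.zero_rpow hq.ne']
  | succ N ih =>
    rw [Finset.sum_range_succ]
    have hN : (0 : ℝ) < (N : ℝ) + 1 := by positivity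
    -- Bernoulli's inequality for `N = (N + 1) (1 - 1 / (N + 1))`
    have h1 : (1 + -(1 / ((N : ℝ) + 1))) ^ (1 - p) ≤ 1 + (1 - p) * -(1 / ((N : ℝ) + 1)) :=
      rpow_one_add_le_one_add_mul_self (by
        rw [neg_le_neg_iff, div_le_one hN]; linarith [(Nat.cast_nonneg N : (0 : ℝ) ≤ N)])
        hq.le (by linarith)
    have h2 : (N : ℝ) ^ (1 - p)
        = ((N : ℝ) + 1) ^ (1 - p) * (1 + -(1 / ((N : ℝ) + 1))) ^ (1 - p) := by
      rw [← Real.mul_rpow hN.le]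
      · congr 1; field_simp; ring
      · rw [le_add_neg_iff_add_le, zero_add, div_le_one hN]
        linarith [(Nat.cast_nonneg N : (0 : ℝ) ≤ N)]
    have h3 : ((N : ℝ) + 1) ^ (1 - p) = ((N : ℝ) + 1) ^ (-p) * (N + 1) := by
      rw [← Real.rpow_add_one hN.ne']; ring_nf
    have h4 := mul_le_mul_of_nonneg_left h1 (show 0 ≤ ((N : ℝ) + 1) ^ (1 - p) by positivity)
    rw [← h2] at h4
    have h5 : ((N : ℝ) + 1) ^ (1 - p) * (1 + (1 - p) * -(1 / ((N : ℝ) + 1)))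
        = ((N : ℝ) + 1) ^ (1 - p) - (1 - p) * ((N : ℝ) + 1) ^ (-p) := by
      rw [h3]; field_simp; ring
    rw [h5] at h4
    rw [le_div_iff₀ hq] at ih ⊢
    push_cast
    linarith

lemma sum_sum_le_of_le_rpow_neg {p C : ℝ} (hp0 : 0 < p) (hp1 : p < 1) (hC : 0 ≤ C)
    {a : ℕ → ℕ → ℝ} (hsymm : ∀ i j, a i j = a j i)
    (ha : ∀ i m, a i (i + m) ≤ C * ((m : ℝ) + 1) ^ (-p)) (N : ℕ) :
    ∑ i ∈ Finset.range N, ∑ j ∈ Finset.range N, a i j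
      ≤ 2 * C / (1 - p) * (N * (N : ℝ) ^ (1 - p)) := by
  have hq : 0 < 1 - p := by linarith
  set T := ∑ m ∈ Finset.range N, ((m : ℝ) + 1) ^ (-p) with hT
  have hT' := sum_range_rpow_neg_le hp0 hp1 N
  have hmono {n : ℕ} (hn : n ≤ N) : ∑ m ∈ Finset.range n, ((m : ℝ) + 1) ^ (-p) ≤ T :=
    Finset.sum_le_sum_of_subset_of_nonneg (Finset.range_mono hn) fun _ _ _ => by positivity
  have hi (i : ℕ) (hi : i ∈ Finset.range N) : ∑ j ∈ Finset.range N, a i j ≤ 2 * C * T := by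
    have hi' := (Finset.mem_range.1 hi).le
    rw [← Finset.sum_range_add_sum_Ico _ hi', Finset.sum_Ico_eq_sum_range]
    have h1 : ∑ j ∈ Finset.range i, a i j ≤ C * T := by
      rw [← Finset.sum_range_reflect]
      refine le_trans ?_ (mul_le_mul_of_nonneg_left (hmono hi') hC)
      rw [Finset.mul_sum]
      refine Finset.sum_le_sum fun j hj => ?_
      have hj' := Finset.mem_range.1 hj
      rw [hsymm]
      have h2 := ha (i - 1 - j) (j + 1)
      rw [show i - 1 - j + (j + 1) = i by omega] at h2
      refine h2.trans (mul_le_mul_of_nonneg_left ?_ hC)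
      push_cast
      exact Real.rpow_le_rpow_of_nonpos (by positivity) (by linarith) (by linarith)
    have h2 : ∑ m ∈ Finset.range (N - i), a i (i + m) ≤ C * T := by
      refine le_trans ?_ (mul_le_mul_of_nonneg_left (hmono (Nat.sub_le N i)) hC)
      rw [Finset.mul_sum]
      exact Finset.sum_le_sum fun m _ => ha i m
    linarith
  refine (Finset.sum_le_sum hi).trans ?_
  rw [Finset.sum_const, Finset.card_range, nsmul_eq_mul]
  calc (N : ℝ) * (2 * C * T) ≤ N * (2 * C * ((N : ℝ) ^ (1 - p) / (1 - p))) := by gcongr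
    _ = _ := by ring

lemma selfIntersections_walk_eq {Ω : Type*} (X : ℕ → Ω → ℤ) (N : ℕ) (ω : Ω) :
    selfIntersections (fun n => walk X n ω) N = ∑ i ∈ Finset.range N, ∑ j ∈ Finset.range N,
      {ω | walk X i ω = walk X j ω}.indicator (fun _ => (1 : ℝ)) ω := by
  simp [selfIntersections, Set.indicator]

variable {Ω : Type*} [MeasurableSpace Ω] {P : Measure Ω}

lemma measurable_walk {X : ℕ → Ω → ℤ} (hXm : ∀ n, Measurable (X n)) (n : ℕ) :
    Measurable (walk X n) :=
  Finset.measurable_fun_sum _ fun m _ => hXm m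

/-- The expected number of self-intersections is of order at most `N ^ (2 - p)`. -/
lemma exists_integral_selfIntersections_le [IsProbabilityMeasure P] {X : ℕ → Ω → ℤ}
    (hXm : ∀ n, Measurable (X n))
    (hXindep : iIndepFun X P) (hXid : ∀ n, IdentDistrib (X n) (X 0) P P)
    (hXaper : WalkStronglyAperiodic P X)
    {α : ℝ} (hα : 0 < α) {F : Measure ℝ} [IsProbabilityMeasure F]
    (hF : ∀ c : ℝ, F ≠ Measure.dirac c)
    (hX : NormallyAttracted P (fun n ω => (X n ω : ℝ)) α F)
    {p : ℝ} (hp0 : 0 < p) (hp1 : p < 1) (hpα : α * p < 1) :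
    ∃ C : ℝ, 0 ≤ C ∧ ∀ N : ℕ,
      Integrable (fun ω => selfIntersections (fun n => walk X n ω) N) P ∧
      ∫ ω, selfIntersections (fun n => walk X n ω) N ∂P ≤ C * (N * (N : ℝ) ^ (1 - p)) := by
  obtain ⟨C, hC, h⟩ := exists_measureReal_sum_eq_zero_le hXm hXindep hXid hXaper hα hF hX
    hp0 hp1 hpα
  refine ⟨2 * (1 + 2 * C) / (1 - p), div_nonneg (by positivity) (by linarith), fun N => ?_⟩
  have hms (i j : ℕ) : MeasurableSet {ω | walk X i ω = walk X j ω} :=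
    measurableSet_eq_fun (measurable_walk hXm i) (measurable_walk hXm j)
  have hint (i j : ℕ) :
      Integrable ({ω | walk X i ω = walk X j ω}.indicator fun _ => (1 : ℝ)) P :=
    (integrable_const _).indicator (hms i j)
  simp_rw [selfIntersections_walk_eq]
  refine ⟨integrable_finsetSum _ fun i _ => integrable_finsetSum _ fun j _ => hint i j, ?_⟩
  rw [integral_finsetSum _ fun i _ => integrable_finsetSum _ fun j _ => hint i j]
  simp_rw [integral_finsetSum _ fun j _ => hint _ j, integral_indicator_const _ (hms _ _),
    smul_eq_mul, mul_one]
  refine sum_sum_le_of_le_rpow_neg hp0 hp1 (by positivity) (fun i j => by simp_rw [eq_comm])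
    (fun i m => ?_) N
  rcases Nat.eq_zero_or_pos m with rfl | hm
  · refine measureReal_le_one.trans ?_
    simp
    linarith
  · have h1 := h (Finset.Ico i (i + m)) (by simpa using hm)
    rw [Nat.card_Ico, Nat.add_sub_cancel_left] at h1
    have h2 : {ω | walk X i ω = walk X (i + m) ω}
        = {ω | ∑ l ∈ Finset.Ico i (i + m), X l ω = 0} := by
      ext ω
      simp only [Set.mem_ofPred_eq, walk]
      rw [← Finset.sum_range_add_sum_Ico _ (Nat.le_add_right i m)]
      omega
    rw [h2]
    refine h1.trans ?_
    have hm' : (1 : ℝ) ≤ m := by exact_mod_cast hm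
    -- `m ^ (-p) ≤ 2 (m + 1) ^ (-p)` since `m + 1 ≤ 2 m`
    have h3 : (m : ℝ) ^ (-p) ≤ 2 * ((m : ℝ) + 1) ^ (-p) := by
      have h4 : (2 * (m : ℝ)) ^ (-p) ≤ ((m : ℝ) + 1) ^ (-p) :=
        Real.rpow_le_rpow_of_nonpos (by positivity) (by linarith) (by linarith)
      have h5 : (1 : ℝ) / 2 ≤ 2 ^ (-p) := by
        rw [one_div, ← Real.rpow_neg_one]
        exact Real.rpow_le_rpow_of_exponent_le (by norm_num) (by linarith)
      rw [Real.mul_rpow (by norm_num) (by positivity)] at h4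
      have h6 : 0 ≤ (m : ℝ) ^ (-p) := by positivity
      nlinarith
    have h7 : 0 ≤ ((m : ℝ) + 1) ^ (-p) := by positivity
    nlinarith

/-- Conditioning on the walk: in an expectation, walk and scenery may be sampled separately. -/
lemma lintegral_walk_scenery_eq [IsProbabilityMeasure P] {X : ℕ → Ω → ℤ}
    (hXm : ∀ n, Measurable (X n)) {ξ : ℤ → Ω → ℝ} (hξm : ∀ i, Measurable (ξ i))
    (hXξ : IndepFun (fun ω n => X n ω) (fun ω i => ξ i ω) P)
    {f : (ℕ → ℤ) × (ℤ → ℝ) → ENNReal} (hf : Measurable f) :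
    ∫⁻ ω, f (fun n => walk X n ω, fun i => ξ i ω) ∂P
      = ∫⁻ ω, ∫⁻ ω', f (fun n => walk X n ω, fun i => ξ i ω') ∂P ∂P := by
  have hW : Measurable fun ω n => walk X n ω := measurable_pi_lambda _ (measurable_walk hXm)
  have hZ : Measurable fun ω i => ξ i ω := measurable_pi_lambda _ hξm
  have hg : Measurable fun (x : ℕ → ℤ) (n : ℕ) => ∑ m ∈ Finset.range n, x m :=
    measurable_pi_lambda _ fun n => Finset.measurable_fun_sum _ fun m _ => measurable_pi_apply m
  have hind : IndepFun (fun ω n => walk X n ω) (fun ω i => ξ i ω) P := hXξ.comp hg measurable_id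
  have hmap := (indepFun_iff_map_prod_eq_prod_map_map hW.aemeasurable hZ.aemeasurable).1 hind
  have : IsProbabilityMeasure (P.map fun ω i => ξ i ω) :=
    Measure.isProbabilityMeasure_map hZ.aemeasurable
  have h1 := lintegral_map (μ := P) hf (hW.prodMk hZ)
  rw [← h1, hmap, lintegral_prod _ hf.aemeasurable,
    lintegral_map hf.lintegral_prod_right' hW]
  refine lintegral_congr fun ω => ?_
  exact lintegral_map (f := fun z => f (fun n => walk X n ω, z))
    (hf.comp measurable_prodMk_left) hZ

lemma measurable_scenery_at (i : ℕ) :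
    Measurable fun q : (ℕ → ℤ) × (ℤ → ℝ) => q.2 (q.1 i) := by
  have h1 : Measurable fun q : ℤ × (ℤ → ℝ) => q.2 q.1 :=
    measurable_from_prod_countable_right fun m => measurable_pi_apply m
  have h2 : Measurable fun q : (ℕ → ℤ) × (ℤ → ℝ) => (q.1 i, q.2) := by fun_prop
  exact h1.comp h2

lemma measurableSet_meet (i j : ℕ) :
    MeasurableSet {q : (ℕ → ℤ) × (ℤ → ℝ) | q.1 i = q.1 j} :=
  measurableSet_eq_fun (by fun_prop) (by fun_prop)

lemma measurable_offDiagTerm {k : ℝ → ℝ → ℝ} (hk : Measurable (Function.uncurry k)) (j : ℕ) :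
    Measurable fun q : (ℕ → ℤ) × (ℤ → ℝ) => offDiagTerm k q.1 q.2 j :=
  Finset.measurable_fun_sum _ fun i _ => Measurable.ite (measurableSet_meet i j) measurable_const
    (hk.comp ((measurable_scenery_at i).prodMk (measurable_scenery_at j)))

lemma measurable_dyadicEnergy {α : Type*} [MeasurableSpace α] {d : ℕ → α → ℝ}
    (hd : ∀ j, Measurable (d j)) (η : ℝ) (L a : ℕ) :
    Measurable fun q => dyadicEnergy (fun j => d j q) η L a := by
  induction L generalizing a with
  | zero => exact (hd a).abs.pow_const η
  | succ L ih =>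
    unfold dyadicEnergy
    exact (((Finset.measurable_fun_sum _ fun j _ => hd j).abs.pow_const η).add (ih a)).add
      (ih (a + 2 ^ L))

/-- A majorant, monotone in time, of the part of the double sum over pairs of times at which the
path is at the same site. -/
def diagMajorant (k : ℝ → ℝ → ℝ) (w : ℕ → ℤ) (z : ℤ → ℝ) (N : ℕ) : ℝ :=
  ∑ i ∈ Finset.range N, ∑ j ∈ Finset.range N,
    if w i = w j then |k (z (w j)) (z (w j))| else 0

lemma measurable_diagMajorant {k : ℝ → ℝ → ℝ} (hk : Measurable (Function.uncurry k)) (N : ℕ) :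
    Measurable fun q : (ℕ → ℤ) × (ℤ → ℝ) => diagMajorant k q.1 q.2 N :=
  Finset.measurable_fun_sum _ fun i _ => Finset.measurable_fun_sum _ fun j _ =>
    Measurable.ite (measurableSet_meet i j)
      (hk.comp ((measurable_scenery_at j).prodMk (measurable_scenery_at j))).abs measurable_const

lemma diagMajorant_nonneg (k : ℝ → ℝ → ℝ) (w : ℕ → ℤ) (z : ℤ → ℝ) (N : ℕ) :
    0 ≤ diagMajorant k w z N :=
  Finset.sum_nonneg fun _ _ => Finset.sum_nonneg fun _ _ => by split_ifs <;> positivity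

lemma integral_diagMajorant {k : ℝ → ℝ → ℝ} (hk : Measurable (Function.uncurry k))
    {ξ : ℤ → Ω → ℝ} {ν : Measure ℝ} (hξ : ∀ i, Measurable (ξ i)) (hν : ∀ i, P.map (ξ i) = ν)
    (hkk : Integrable (fun x => k x x) ν) (w : ℕ → ℤ) (N : ℕ) :
    Integrable (fun ω => diagMajorant k w (fun i => ξ i ω) N) P ∧
    ∫ ω, diagMajorant k w (fun i => ξ i ω) N ∂P
      = selfIntersections w N * ∫ x, |k x x| ∂ν := by
  have hm : Measurable fun x => |k x x| := (hk.comp (measurable_id.prodMk measurable_id)).abs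
  have h1 (x : ℤ) : Integrable (fun ω => |k (ξ x ω) (ξ x ω)|) P := by
    have h := hkk.abs
    rw [← hν x] at h
    exact (integrable_map_measure hm.aestronglyMeasurable (hξ x).aemeasurable).1 h
  have h2 (x : ℤ) : ∫ ω, |k (ξ x ω) (ξ x ω)| ∂P = ∫ x, |k x x| ∂ν := by
    rw [← hν x, integral_map (hξ x).aemeasurable hm.aestronglyMeasurable]
  have h3 (i j : ℕ) : Integrable (fun ω => if w i = w j then |k (ξ (w j) ω) (ξ (w j) ω)| else 0) P ∧
      ∫ ω, (if w i = w j then |k (ξ (w j) ω) (ξ (w j) ω)| else 0) ∂P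
        = (if w i = w j then 1 else 0) * ∫ x, |k x x| ∂ν := by
    split_ifs
    · exact ⟨h1 _, by rw [h2, one_mul]⟩
    · simp
  unfold diagMajorant selfIntersections
  refine ⟨integrable_finsetSum _ fun i _ => integrable_finsetSum _ fun j _ => (h3 i j).1, ?_⟩
  rw [integral_finsetSum _ fun i _ => integrable_finsetSum _ fun j _ => (h3 i j).1]
  simp_rw [integral_finsetSum _ fun j _ => (h3 _ j).1, (h3 _ _).2, Finset.sum_mul]

/-- Borel–Cantelli in the form: nonnegative variables with summable means tend to `0`. -/
lemma ae_tendsto_zero_of_lintegral_le {f : ℕ → Ω → ℝ} (hf : ∀ L, Measurable (f L))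
    (hf0 : ∀ L ω, 0 ≤ f L ω) {u : ℕ → ℝ} (hu0 : ∀ L, 0 ≤ u L) (hu : Summable u)
    (h : ∀ L, ∫⁻ ω, ENNReal.ofReal (f L ω) ∂P ≤ ENNReal.ofReal (u L)) :
    ∀ᵐ ω ∂P, Tendsto (fun L => f L ω) atTop (𝓝 0) := by
  have h1 : ∫⁻ ω, ∑' L, ENNReal.ofReal (f L ω) ∂P ≠ ⊤ := by
    rw [lintegral_tsum fun L => (hf L).ennreal_ofReal.aemeasurable]
    refine ne_top_of_le_ne_top ?_ (ENNReal.tsum_le_tsum h)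
    rw [← ENNReal.ofReal_tsum_of_nonneg hu0 hu]
    exact ENNReal.ofReal_ne_top
  filter_upwards [ae_lt_top (Measurable.tsum fun L => (hf L).ennreal_ofReal) h1] with ω hω
  have h2 := ENNReal.tendsto_atTop_zero_of_tsum_ne_top hω.ne
  have h3 := (ENNReal.tendsto_toReal ENNReal.zero_ne_top).comp h2
  simpa [Function.comp_def, ENNReal.toReal_ofReal (hf0 _ ω)] using h3

end SelfIntersections

/-! ### The Hoeffding projection and conditional moment bounds -/

section Projection

variable {Ω : Type*} [MeasurableSpace Ω] {P : Measure Ω}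

lemma integrable_abs_rpow_of_le {α : Type*} [MeasurableSpace α] {μ : Measure α} [IsFiniteMeasure μ]
    {f : α → ℝ} (hf : Measurable f) {η η' : ℝ} (h0 : 0 ≤ η) (hle : η ≤ η')
    (h : Integrable (fun a => |f a| ^ η') μ) : Integrable (fun a => |f a| ^ η) μ := by
  refine ((integrable_const (1 : ℝ)).add h).mono' (hf.abs.pow_const η).aestronglyMeasurable
    (ae_of_all _ fun a => ?_)
  rw [Real.norm_of_nonneg (by positivity), Pi.add_apply]
  have hpos : 0 ≤ |f a| ^ η' := by positivity
  rcases le_total |f a| 1 with h1 | h1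
  · linarith [Real.rpow_le_one (abs_nonneg _) h1 h0]
  · linarith [Real.rpow_le_rpow_of_exponent_le h1 hle]

lemma abs_integral_rpow_le {α : Type*} [MeasurableSpace α] {μ : Measure α} [IsProbabilityMeasure μ]
    {f : α → ℝ} {η : ℝ} (h1 : 1 ≤ η) (hf : Integrable f μ)
    (hfη : Integrable (fun a => |f a| ^ η) μ) :
    |∫ a, f a ∂μ| ^ η ≤ ∫ a, |f a| ^ η ∂μ := by
  refine (Real.rpow_le_rpow (abs_nonneg _) abs_integral_le_integral_abs (by linarith)).trans ?_
  exact (convexOn_rpow h1).map_integral_le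
    (Real.continuous_rpow_const (by linarith)).continuousOn isClosed_Ici
    (ae_of_all _ fun a => abs_nonneg (f a)) hf.abs hfη

lemma hoeffding₁_eq {ξ : ℤ → Ω → ℝ} (hξm : ∀ i, Measurable (ξ i)) {h : ℝ → ℝ → ℝ}
    (hm : Measurable (Function.uncurry h)) (x : ℝ) :
    hoeffding₁ P ξ h x = ∫ y, h x y ∂(P.map (ξ 1)) := by
  rw [integral_map (hξm 1).aemeasurable]
  · rfl
  · exact (hm.comp measurable_prodMk_left).aestronglyMeasurable

lemma degenerateKernel_hoeffding₂ [IsProbabilityMeasure P] {ξ : ℤ → Ω → ℝ}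
    (hξm : ∀ i, Measurable (ξ i)) (hξindep : iIndepFun ξ P)
    (hξid : ∀ i, IdentDistrib (ξ i) (ξ 1) P P)
    {h : ℝ → ℝ → ℝ} (hm : Measurable (Function.uncurry h)) (hsymm : ∀ x y, h x y = h y x)
    (hint12 : Integrable (fun ω => h (ξ 1 ω) (ξ 2 ω)) P)
    (hint11 : Integrable (fun ω => h (ξ 1 ω) (ξ 1 ω)) P)
    (hmean : ∫ ω, h (ξ 1 ω) (ξ 2 ω) ∂P = 0) {η : ℝ} (h1 : 1 ≤ η) (h2 : η ≤ 2)
    (hmoment : Integrable (fun ω => |h (ξ 1 ω) (ξ 2 ω)| ^ η) P) :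
    DegenerateKernel (P.map (ξ 1)) (hoeffding₂ P ξ h) η ∧
      Integrable (fun x => hoeffding₂ P ξ h x x) (P.map (ξ 1)) := by
  set ν := P.map (ξ 1) with hνdef
  have : IsProbabilityMeasure ν := Measure.isProbabilityMeasure_map (hξm 1).aemeasurable
  have hν (i : ℤ) : P.map (ξ i) = ν := (hξid i).map_eq
  have hmap := map_prodMk_eq_prod hξm hξindep hν (show (1 : ℤ) ≠ 2 by norm_num)
  have hpair : AEMeasurable (fun ω => (ξ 1 ω, ξ 2 ω)) P := ((hξm 1).prodMk (hξm 2)).aemeasurable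
  have hi : Integrable (Function.uncurry h) (ν.prod ν) := by
    rw [← hmap]
    exact (integrable_map_measure hm.aestronglyMeasurable hpair).2 hint12
  have hiη : Integrable (fun z : ℝ × ℝ => |h z.1 z.2| ^ η) (ν.prod ν) := by
    rw [← hmap]
    exact (integrable_map_measure (hm.abs.pow_const η).aestronglyMeasurable hpair).2 hmoment
  have hg (x : ℝ) : hoeffding₁ P ξ h x = ∫ y, h x y ∂ν := hoeffding₁_eq hξm hm x
  have hgm : Measurable (hoeffding₁ P ξ h) := by
    rw [funext hg]
    exact (hm.stronglyMeasurable.integral_prod_right (ν := ν)).measurable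
  have hgi : Integrable (hoeffding₁ P ξ h) ν := by
    rw [funext hg]
    exact hi.integral_prod_left
  have hg0 : ∫ x, hoeffding₁ P ξ h x ∂ν = 0 := by
    simp_rw [hg]
    refine (integral_prod (Function.uncurry h) hi).symm.trans ?_
    rw [← hmap, integral_map hpair hm.aestronglyMeasurable]
    exact hmean
  have hgη : Integrable (fun x => |hoeffding₁ P ξ h x| ^ η) ν := by
    refine hiη.integral_prod_left.mono' (hgm.abs.pow_const η).aestronglyMeasurable ?_
    filter_upwards [hi.prod_right_ae, hiη.prod_right_ae] with x hx hxη
    rw [Real.norm_of_nonneg (by positivity), hg]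
    exact abs_integral_rpow_le h1 hx hxη
  have hkm : Measurable (Function.uncurry (hoeffding₂ P ξ h)) :=
    (hm.sub (hgm.comp measurable_fst)).sub (hgm.comp measurable_snd)
  refine ⟨⟨hkm, fun x y => ?_, ?_, ?_⟩, ?_⟩
  · unfold hoeffding₂
    rw [hsymm]; ring
  -- where `h x` is integrable, `h₁ x` is a genuine integral; this is almost every `x`
  · filter_upwards [hi.prod_right_ae] with x hx
    have hx' : Integrable (h x) ν := hx
    have h3 : Integrable (fun y => h x y - hoeffding₁ P ξ h x) ν := hx'.sub (integrable_const _)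
    refine ⟨h3.sub hgi, ?_⟩
    unfold hoeffding₂
    rw [integral_sub h3 hgi, integral_sub hx' (integrable_const _), hg0, ← hg]
    simp
  · refine ((hiη.add ((hgη.comp_fst ν).add (hgη.comp_snd ν))).const_mul 16).mono'
      (hkm.abs.pow_const η).aestronglyMeasurable (ae_of_all _ fun z => ?_)
    rw [Real.norm_of_nonneg (by positivity)]
    simp only [Pi.add_apply]
    have e1 := abs_add_rpow_le_four_mul h1 h2 (h z.1 z.2)
      (-(hoeffding₁ P ξ h z.1 + hoeffding₁ P ξ h z.2))
    have e2 := abs_add_rpow_le_four_mul h1 h2 (hoeffding₁ P ξ h z.1) (hoeffding₁ P ξ h z.2)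
    rw [abs_neg, show h z.1 z.2 + -(hoeffding₁ P ξ h z.1 + hoeffding₁ P ξ h z.2)
      = hoeffding₂ P ξ h z.1 z.2 by unfold hoeffding₂; ring] at e1
    have e3 : 0 ≤ |h z.1 z.2| ^ η := by positivity
    linarith
  · have hd : Integrable (fun x => h x x) ν :=
      (integrable_map_measure (hm.comp (measurable_id.prodMk measurable_id)).aestronglyMeasurable
        (hξm 1).aemeasurable).2 hint11
    exact (hd.sub hgi).sub hgi

/-- Splitting the remainder according to whether the two sites coincide. The time `0`, absent from
the remainder, contributes nothing to the first sum as no `i` satisfies `1 ≤ i < 0`. -/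
lemma abs_hoeffdingRemainder_le {X : ℕ → Ω → ℤ} {ξ : ℤ → Ω → ℝ} {h : ℝ → ℝ → ℝ} {n N : ℕ}
    (hn : n < N) (ω : Ω) :
    |hoeffdingRemainder P X ξ h n ω|
      ≤ |∑ j ∈ Finset.Ico 0 (0 + (n + 1)),
          offDiagTerm (hoeffding₂ P ξ h) (fun m => walk X m ω) (fun i => ξ i ω) j|
        + diagMajorant (hoeffding₂ P ξ h) (fun m => walk X m ω) (fun i => ξ i ω) N := by
  set k := hoeffding₂ P ξ h
  set w : ℕ → ℤ := fun m => walk X m ω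
  set z : ℤ → ℝ := fun i => ξ i ω
  have h1 : hoeffdingRemainder P X ξ h n ω
      = ∑ j ∈ Finset.Ico 0 (0 + (n + 1)), ∑ i ∈ Finset.Ico 1 j, k (z (w i)) (z (w j)) := by
    unfold hoeffdingRemainder
    refine Finset.sum_subset (fun j hj => ?_) fun j hj hj' => ?_
    · simp only [Finset.mem_Icc, Finset.mem_Ico] at hj ⊢; omega
    · have : j = 0 := by simp only [Finset.mem_Icc, Finset.mem_Ico] at hj hj'; omega
      simp [this]
  have h2 : hoeffdingRemainder P X ξ h n ω
      = ∑ j ∈ Finset.Ico 0 (0 + (n + 1)), offDiagTerm k w z j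
        + ∑ j ∈ Finset.Ico 0 (0 + (n + 1)), ∑ i ∈ Finset.Ico 1 j,
          if w i = w j then k (z (w j)) (z (w j)) else 0 := by
    rw [h1, ← Finset.sum_add_distrib]
    unfold offDiagTerm
    refine Finset.sum_congr rfl fun j _ => ?_
    rw [← Finset.sum_add_distrib]
    refine Finset.sum_congr rfl fun i _ => ?_
    split_ifs with he
    · rw [he, zero_add]
    · rw [add_zero]
  rw [h2]
  refine (abs_add_le _ _).trans (add_le_add_right ?_ _)
  unfold diagMajorant
  rw [Finset.sum_comm (s := Finset.range N)]
  have hnn (j i : ℕ) : 0 ≤ if w i = w j then |k (z (w j)) (z (w j))| else 0 := by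
    split_ifs <;> positivity
  calc |∑ j ∈ Finset.Ico 0 (0 + (n + 1)), ∑ i ∈ Finset.Ico 1 j,
        if w i = w j then k (z (w j)) (z (w j)) else 0|
      ≤ ∑ j ∈ Finset.Ico 0 (0 + (n + 1)), ∑ i ∈ Finset.Ico 1 j,
        if w i = w j then |k (z (w j)) (z (w j))| else 0 := by
        refine (Finset.abs_sum_le_sum_abs _ _).trans (Finset.sum_le_sum fun j _ =>
          (Finset.abs_sum_le_sum_abs _ _).trans_eq (Finset.sum_congr rfl fun i _ => ?_))
        split_ifs <;> simp
    _ ≤ ∑ j ∈ Finset.Ico 0 (0 + (n + 1)), ∑ i ∈ Finset.range N,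
        if w i = w j then |k (z (w j)) (z (w j))| else 0 := by
        refine Finset.sum_le_sum fun j hj => Finset.sum_le_sum_of_subset_of_nonneg
          (fun i hi => ?_) fun i _ _ => hnn j i
        simp only [Finset.mem_Ico, Finset.mem_range] at hi hj ⊢
        omega
    _ ≤ _ := by
        refine Finset.sum_le_sum_of_subset_of_nonneg (fun j hj => ?_) fun j _ _ =>
          Finset.sum_nonneg fun i _ => hnn j i
        simp only [Finset.mem_Ico, Finset.mem_range] at hj ⊢
        omega

section Expectations

variable [IsProbabilityMeasure P] {X : ℕ → Ω → ℤ} {ξ : ℤ → Ω → ℝ} {ν : Measure ℝ}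
  {k : ℝ → ℝ → ℝ} {η p C : ℝ}

lemma lintegral_diagMajorant_le (hXm : ∀ n, Measurable (X n)) (hξm : ∀ i, Measurable (ξ i))
    (hXξ : IndepFun (fun ω n => X n ω) (fun ω i => ξ i ω) P) (hν : ∀ i, P.map (ξ i) = ν)
    (hk : Measurable (Function.uncurry k)) (hkk : Integrable (fun x => k x x) ν) {N : ℕ}
    (hVi : Integrable (fun ω => selfIntersections (fun n => walk X n ω) N) P)
    (hV : ∫ ω, selfIntersections (fun n => walk X n ω) N ∂P ≤ C * (N * (N : ℝ) ^ (1 - p))) :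
    ∫⁻ ω, ENNReal.ofReal (diagMajorant k (fun n => walk X n ω) (fun i => ξ i ω) N) ∂P
      ≤ ENNReal.ofReal (C * (N * (N : ℝ) ^ (1 - p)) * ∫ x, |k x x| ∂ν) := by
  have hV0 (w : ℕ → ℤ) : 0 ≤ selfIntersections w N :=
    (Nat.cast_nonneg N).trans (natCast_le_selfIntersections w N)
  have hD : 0 ≤ ∫ x, |k x x| ∂ν := integral_nonneg fun x => abs_nonneg _
  rw [lintegral_walk_scenery_eq hXm hξm hXξ
    (f := fun q => ENNReal.ofReal (diagMajorant k q.1 q.2 N))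
    (measurable_diagMajorant hk N).ennreal_ofReal]
  have h1 (ω : Ω) : ∫⁻ ω', ENNReal.ofReal
      (diagMajorant k (fun n => walk X n ω) (fun i => ξ i ω') N) ∂P
      = ENNReal.ofReal (selfIntersections (fun n => walk X n ω) N * ∫ x, |k x x| ∂ν) := by
    obtain ⟨i1, i2⟩ := integral_diagMajorant (P := P) hk hξm hν hkk (fun n => walk X n ω) N
    rw [← i2, ofReal_integral_eq_lintegral_ofReal i1
      (ae_of_all _ fun ω' => diagMajorant_nonneg ..)]
  simp_rw [h1]
  rw [← ofReal_integral_eq_lintegral_ofReal (hVi.mul_const _)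
    (ae_of_all _ fun ω => mul_nonneg (hV0 _) hD), integral_mul_const]
  exact ENNReal.ofReal_le_ofReal (mul_le_mul_of_nonneg_right hV hD)

/-- The off-diagonal bound averaged over the walk. As `η ≤ 3 / 2`, the power `2 (η - 1)` of the
number of self-intersections is at most `1`, so that its first moment suffices. -/
lemma lintegral_dyadicEnergy_le (hXm : ∀ n, Measurable (X n)) (hξm : ∀ i, Measurable (ξ i))
    (hind : iIndepFun ξ P)
    (hXξ : IndepFun (fun ω n => X n ω) (fun ω i => ξ i ω) P) (hν : ∀ i, P.map (ξ i) = ν)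
    (hk : DegenerateKernel ν k η) (h1 : 1 ≤ η) (h2 : η ≤ 3 / 2) (L : ℕ)
    (hVi : Integrable (fun ω => selfIntersections (fun n => walk X n ω) (2 ^ L)) P)
    (hV : ∫ ω, selfIntersections (fun n => walk X n ω) (2 ^ L) ∂P
      ≤ C * ((2 ^ L : ℕ) * ((2 ^ L : ℕ) : ℝ) ^ (1 - p))) :
    ∫⁻ ω, ENNReal.ofReal
        (dyadicEnergy (offDiagTerm k (fun n => walk X n ω) fun i => ξ i ω) η L 0) ∂P
      ≤ ENNReal.ofReal (((L : ℝ) + 1) * (256 * (∫ z, |k z.1 z.2| ^ η ∂(ν.prod ν)) * (1 + C)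
          * (((2 ^ L : ℕ) : ℝ) ^ 2 * (((2 ^ L : ℕ) : ℝ) ^ (1 - p)) ^ (2 * (η - 1))))) := by
  set A := ∫ z, |k z.1 z.2| ^ η ∂(ν.prod ν) with hA
  have hA0 : 0 ≤ A := integral_nonneg fun z => by positivity
  set N : ℕ := 2 ^ L with hN
  have hNpos : (0 : ℝ) < N := by rw [hN]; positivity
  set B : ℝ := (N : ℝ) ^ (1 - p) with hB
  have hBpos : 0 < B := by positivity
  have hV0 (w : ℕ → ℤ) : 0 ≤ selfIntersections w N :=
    (Nat.cast_nonneg N).trans (natCast_le_selfIntersections w N)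
  rw [lintegral_walk_scenery_eq hXm hξm hXξ
    (f := fun q => ENNReal.ofReal (dyadicEnergy (offDiagTerm k q.1 q.2) η L 0))
    (measurable_dyadicEnergy (fun j => measurable_offDiagTerm hk.measurable j) η L
      0).ennreal_ofReal]
  set c : ℝ := ((L : ℝ) + 1) * (256 * A * (N : ℝ) ^ 2) with hc
  have hc0 : 0 ≤ c := by positivity
  -- conditionally on the walk
  have hin (ω : Ω) : ∫⁻ ω', ENNReal.ofReal
        (dyadicEnergy (offDiagTerm k (fun n => walk X n ω) fun i => ξ i ω') η L 0) ∂P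
      ≤ ENNReal.ofReal (c * (B ^ (2 * (η - 1)) + B ^ (2 * (η - 1) - 1) *
          (selfIntersections (fun n => walk X n ω) N / N))) := by
    obtain ⟨i1, i2⟩ := hk.integral_dyadicEnergy_offDiag_le h1 (by linarith) hξm hind hν
      (fun n => walk X n ω) L
    rw [← ofReal_integral_eq_lintegral_ofReal i1 (ae_of_all _ fun ω' => dyadicEnergy_nonneg ..)]
    refine ENNReal.ofReal_le_ofReal (i2.trans ?_)
    rw [← hN]
    have hv : 0 ≤ selfIntersections (fun n => walk X n ω) N / N := div_nonneg (hV0 _) hNpos.le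
    have h3 := rpow_le_rpow_add_mul (r := 2 * (η - 1)) (by linarith) (by linarith) hv hBpos
    have h4 : ((selfIntersections (fun n => walk X n ω) N / N) ^ (η - 1)) ^ 2
        = (selfIntersections (fun n => walk X n ω) N / N) ^ (2 * (η - 1)) := by
      rw [← Real.rpow_natCast, ← Real.rpow_mul hv]; push_cast; ring_nf
    rw [mul_pow, h4]
    have h5 := mul_le_mul_of_nonneg_left h3 hc0
    refine le_trans (le_of_eq ?_) h5
    rw [hc]; ring
  refine (lintegral_mono hin).trans ?_
  have hint : Integrable (fun ω => c * (B ^ (2 * (η - 1)) + B ^ (2 * (η - 1) - 1) *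
      (selfIntersections (fun n => walk X n ω) N / N))) P :=
    ((integrable_const _).add ((hVi.div_const _).const_mul _)).const_mul _
  rw [← ofReal_integral_eq_lintegral_ofReal hint (ae_of_all _ fun ω => by
    have := hV0 fun n => walk X n ω
    simp only [Pi.zero_apply]
    positivity)]
  refine ENNReal.ofReal_le_ofReal ?_
  rw [integral_const_mul, integral_add (integrable_const _) ((hVi.div_const _).const_mul _),
    integral_const_mul, integral_div]
  simp only [integral_const, probReal_univ, smul_eq_mul, one_mul]
  have h6 : (∫ ω, selfIntersections (fun n => walk X n ω) N ∂P) / N ≤ C * B := by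
    rw [div_le_iff₀ hNpos]; linarith
  have h7 : B ^ (2 * (η - 1) - 1) * (C * B) = C * B ^ (2 * (η - 1)) := by
    rw [Real.rpow_sub_one hBpos.ne']; field_simp
  calc c * (B ^ (2 * (η - 1)) + B ^ (2 * (η - 1) - 1)
        * ((∫ ω, selfIntersections (fun n => walk X n ω) N ∂P) / N))
      ≤ c * (B ^ (2 * (η - 1)) + B ^ (2 * (η - 1) - 1) * (C * B)) := by gcongr
    _ = _ := by rw [h7, hc]; ring

end Expectations

end Projection

/-! ### Almost sure rates -/

section Rates

variable {Ω : Type*} [MeasurableSpace Ω] {P : Measure Ω}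

lemma natCast_two_pow_rpow (L : ℕ) (x : ℝ) : ((2 ^ L : ℕ) : ℝ) ^ x = ((2 : ℝ) ^ x) ^ L := by
  push_cast
  rw [← Real.rpow_natCast, ← Real.rpow_natCast, ← Real.rpow_mul (by norm_num),
    ← Real.rpow_mul (by norm_num), mul_comm]

lemma summable_add_one_rpow_mul_geometric {ρ η : ℝ} (hρ0 : 0 < ρ) (hρ1 : ρ < 1) (hη : η ≤ 2) :
    Summable fun L : ℕ => ((L : ℝ) + 1) ^ η * ρ ^ L := by
  have h1 : Summable fun L : ℕ => (L : ℝ) ^ 2 * ρ ^ L :=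
    summable_pow_mul_geometric_of_norm_lt_one 2 (by rwa [Real.norm_of_nonneg hρ0.le])
  have h2 := ((summable_nat_add_iff 1).2 h1).mul_left ρ⁻¹
  refine h2.of_nonneg_of_le (fun L => by positivity) fun L => ?_
  have h3 : ((L : ℝ) + 1) ^ η ≤ ((L : ℝ) + 1) ^ 2 := by
    rw [← Real.rpow_two]
    exact Real.rpow_le_rpow_of_exponent_le (by linarith [(Nat.cast_nonneg L : (0 : ℝ) ≤ L)]) hη
  calc ((L : ℝ) + 1) ^ η * ρ ^ L ≤ ((L : ℝ) + 1) ^ 2 * ρ ^ L := by gcongr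
    _ = _ := by push_cast; field_simp; ring

/-- A bound on all dyadic initial segments with a vanishing factor gives the rate along all `n`.
-/
lemma isLittleO_sup'_of_dyadic {R ε : ℕ → ℝ} {γ : ℝ} (hγ : 0 ≤ γ)
    (hε : Tendsto ε atTop (𝓝 0))
    (hR : ∀ L n, n < 2 ^ L → |R n| ≤ ε L * ((2 ^ L : ℕ) : ℝ) ^ γ) :
    (fun n : ℕ => (Finset.range (n + 1)).sup' Finset.nonempty_range_add_one fun k => |R k|)
      =o[atTop] fun n : ℕ => (n : ℝ) ^ γ := by
  have hL : Tendsto (fun n : ℕ => Nat.log 2 n + 1) atTop atTop :=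
    by
    refine tendsto_atTop.2 fun b => ?_
    filter_upwards [eventually_ge_atTop (2 ^ b)] with n hn
    exact (Nat.le_log_of_pow_le (by norm_num) hn).trans (Nat.le_succ _)
  have h0 : (fun n : ℕ => ε (Nat.log 2 n + 1) * 2 ^ γ) =o[atTop] fun _ => (1 : ℝ) := by
    rw [isLittleO_one_iff]
    simpa using (hε.comp hL).mul_const ((2 : ℝ) ^ γ)
  have h1 := h0.mul_isBigO (isBigO_refl (fun n : ℕ => (n : ℝ) ^ γ) atTop)
  simp only [one_mul] at h1
  refine IsBigO.trans_isLittleO (IsBigO.of_bound 1 ?_) h1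
  filter_upwards [eventually_ge_atTop 1] with n hn
  set L := Nat.log 2 n + 1
  have hlt : n < 2 ^ L := Nat.lt_pow_succ_log_self (by norm_num) n
  have hle : ((2 ^ L : ℕ) : ℝ) ≤ 2 * n := by
    have := Nat.pow_log_le_self 2 (show n ≠ 0 by omega)
    have h3 : 2 ^ L = 2 * 2 ^ Nat.log 2 n := by rw [pow_succ, mul_comm]
    rw [h3]; exact_mod_cast Nat.mul_le_mul_left 2 this
  have hεL : 0 ≤ ε L := by
    have h2 := (abs_nonneg _).trans (hR L n hlt)
    exact nonneg_of_mul_nonneg_left h2 (by positivity)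
  have hsup : (Finset.range (n + 1)).sup' Finset.nonempty_range_add_one (fun k => |R k|)
      ≤ ε L * 2 ^ γ * (n : ℝ) ^ γ := by
    refine Finset.sup'_le _ _ fun k hk => (hR L k ?_).trans ?_
    · exact (Nat.lt_succ_iff.1 (Finset.mem_range.1 hk)).trans_lt hlt
    · rw [mul_assoc, ← Real.mul_rpow (by norm_num) (by positivity)]
      exact mul_le_mul_of_nonneg_left (Real.rpow_le_rpow (by positivity) hle hγ) hεL
  have hsup0 : 0 ≤ (Finset.range (n + 1)).sup' Finset.nonempty_range_add_one fun k => |R k| :=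
    (abs_nonneg (R 0)).trans (Finset.le_sup' (fun k => |R k|) (by simp))
  rw [Real.norm_of_nonneg hsup0, Real.norm_of_nonneg (by positivity), one_mul]
  exact hsup

/-- Room for an exponent `p < 1 / max 1 α` of the return probabilities. At `p = 1 / max 1 α` the
difference of the two sides of the last inequality is
`(η (1 + 1 / β) - 2) / max 1 α`, positive because `η > 2 β / (1 + β)`. -/
lemma exists_exponent {α β β'' η : ℝ} (hα : 0 < α) (hβ : 1 < β) (hβ'' : β < β'')
    (hη : η = 2 * β'' / (1 + β'')) (hη2 : η ≤ 3 / 2) :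
    ∃ p : ℝ, 0 < p ∧ p < 1 ∧ α * p < 1 ∧
      2 - p < 2 - 1 / max 1 α + 1 / (max 1 α * β) ∧
      2 + (1 - p) * (2 * (η - 1)) < (2 - 1 / max 1 α + 1 / (max 1 α * β)) * η := by
  have hmax : 0 < max 1 α := lt_max_of_lt_left one_pos
  set q := 1 / max 1 α with hq
  have hq0 : 0 < q := by positivity
  have hq1 : q ≤ 1 := by rw [hq, div_le_one hmax]; exact le_max_left _ _
  have hqα : α * q ≤ 1 := by
    rw [hq, mul_one_div, div_le_one hmax]; exact le_max_right _ _
  have hqβ : 1 / (max 1 α * β) = q * (1 / β) := by rw [hq, div_mul_div_comm, one_mul]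
  set b := 1 / β with hb
  have hb0 : 0 < b := by positivity
  have hb1 : b < 1 := by rw [hb, div_lt_one (by linarith)]; exact hβ
  rw [hqβ]
  -- `η` exceeds the exponent `2 β / (1 + β)` for which the two rates coincide
  have hκ : 0 < η * (1 + b) - 2 := by
    have h1 : 2 * β / (1 + β) < η := by
      rw [hη, div_lt_div_iff₀ (by linarith) (by linarith)]; nlinarith
    rw [div_lt_iff₀ (by linarith)] at h1
    have h2 : η * (1 + b) = η * (1 + β) * b := by rw [hb]; field_simp; ring
    have h3 : 2 = 2 * β * b := by rw [hb]; field_simp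
    rw [h2]; nlinarith
  have hη1 : 1 ≤ η := by nlinarith
  set m := min ((η * (1 + b) - 2) / 4) (b / 2) with hm
  have hm0 : 0 < m := lt_min (by linarith) (by linarith)
  have hm1 : m ≤ (η * (1 + b) - 2) / 4 := min_le_left _ _
  have hm2 : m ≤ b / 2 := min_le_right _ _
  have hpq : q * (1 - m) < q := by nlinarith
  refine ⟨q * (1 - m), mul_pos hq0 (by linarith), by linarith, ?_, by nlinarith, ?_⟩
  · nlinarith
  · have h4 : (2 - q + q * b) * η - (2 + (1 - q * (1 - m)) * (2 * (η - 1)))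
        = q * ((η * (1 + b) - 2) - m * (2 * (η - 1))) := by ring
    have h5 : 0 < (η * (1 + b) - 2) - m * (2 * (η - 1)) := by nlinarith
    have h6 := mul_pos hq0 h5
    linarith

lemma lintegral_ofReal_const_mul_le {c : ℝ} (hc : 0 ≤ c) {g : Ω → ℝ} (hg : Measurable g) {v : ℝ}
    (hgv : ∫⁻ ω, ENNReal.ofReal (g ω) ∂P ≤ ENNReal.ofReal v) :
    ∫⁻ ω, ENNReal.ofReal (c * g ω) ∂P ≤ ENNReal.ofReal (c * v) := by
  simp_rw [ENNReal.ofReal_mul hc]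
  rw [lintegral_const_mul _ hg.ennreal_ofReal]
  gcongr

section AlmostSure

variable [IsProbabilityMeasure P] {X : ℕ → Ω → ℤ} {ξ : ℤ → Ω → ℝ} {ν : Measure ℝ}
  {k : ℝ → ℝ → ℝ} {η p C γ : ℝ}

lemma ae_tendsto_dyadicEnergy (hXm : ∀ n, Measurable (X n)) (hξm : ∀ i, Measurable (ξ i))
    (hind : iIndepFun ξ P)
    (hXξ : IndepFun (fun ω n => X n ω) (fun ω i => ξ i ω) P) (hν : ∀ i, P.map (ξ i) = ν)
    (hk : DegenerateKernel ν k η) (h1 : 1 ≤ η) (h2 : η ≤ 3 / 2) (hC : 0 ≤ C)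
    (hV : ∀ N : ℕ, Integrable (fun ω => selfIntersections (fun n => walk X n ω) N) P ∧
      ∫ ω, selfIntersections (fun n => walk X n ω) N ∂P ≤ C * (N * (N : ℝ) ^ (1 - p)))
    (hγ : 2 + (1 - p) * (2 * (η - 1)) < γ * η) :
    ∀ᵐ ω ∂P, Tendsto (fun L : ℕ => ((L : ℝ) + 1) ^ (η - 1) / ((2 ^ L : ℕ) : ℝ) ^ (γ * η) *
      dyadicEnergy (offDiagTerm k (fun n => walk X n ω) fun i => ξ i ω) η L 0) atTop (𝓝 0) := by
  have hA0 : 0 ≤ ∫ z, |k z.1 z.2| ^ η ∂(ν.prod ν) := integral_nonneg fun z => by positivity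
  have hm (L : ℕ) : Measurable fun ω =>
      dyadicEnergy (offDiagTerm k (fun n => walk X n ω) fun i => ξ i ω) η L 0 :=
    (measurable_dyadicEnergy (fun j => measurable_offDiagTerm hk.measurable j) η L 0).comp
      ((measurable_pi_lambda _ (measurable_walk hXm)).prodMk (measurable_pi_lambda _ hξm))
  have hsum := (summable_add_one_rpow_mul_geometric
    (ρ := (2 : ℝ) ^ (2 + (1 - p) * (2 * (η - 1)) - γ * η)) (η := η) (by positivity)
    (Real.rpow_lt_one_of_one_lt_of_neg (by norm_num) (by linarith)) (by linarith)).mul_left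
    (256 * (∫ z, |k z.1 z.2| ^ η ∂(ν.prod ν)) * (1 + C))
  refine ae_tendsto_zero_of_lintegral_le (fun L => (hm L).const_mul _)
    (fun L ω => mul_nonneg (by positivity) (dyadicEnergy_nonneg ..)) (fun L => by positivity)
    hsum fun L => ?_
  refine (lintegral_ofReal_const_mul_le (by positivity) (hm L) (lintegral_dyadicEnergy_le hXm hξm
    hind hXξ hν hk h1 h2 L (hV _).1 (hV _).2)).trans_eq ?_
  refine congrArg ENNReal.ofReal ?_
  have hN : (0 : ℝ) < ((2 ^ L : ℕ) : ℝ) := by positivity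
  have hL : (0 : ℝ) < (L : ℝ) + 1 := by positivity
  rw [← natCast_two_pow_rpow, Real.rpow_sub hN _ (γ * η), Real.rpow_add hN,
    Real.rpow_mul hN.le (1 - p), Real.rpow_two, Real.rpow_sub_one hL.ne']
  field_simp

lemma ae_tendsto_diagMajorant (hXm : ∀ n, Measurable (X n)) (hξm : ∀ i, Measurable (ξ i))
    (hXξ : IndepFun (fun ω n => X n ω) (fun ω i => ξ i ω) P) (hν : ∀ i, P.map (ξ i) = ν)
    (hk : Measurable (Function.uncurry k)) (hkk : Integrable (fun x => k x x) ν) (hC : 0 ≤ C)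
    (hV : ∀ N : ℕ, Integrable (fun ω => selfIntersections (fun n => walk X n ω) N) P ∧
      ∫ ω, selfIntersections (fun n => walk X n ω) N ∂P ≤ C * (N * (N : ℝ) ^ (1 - p)))
    (hγ : 2 - p < γ) :
    ∀ᵐ ω ∂P, Tendsto (fun L : ℕ => 1 / ((2 ^ L : ℕ) : ℝ) ^ γ *
      diagMajorant k (fun n => walk X n ω) (fun i => ξ i ω) (2 ^ L)) atTop (𝓝 0) := by
  have hD0 : 0 ≤ ∫ x, |k x x| ∂ν := integral_nonneg fun x => abs_nonneg _
  have hm (L : ℕ) : Measurable fun ω =>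
      diagMajorant k (fun n => walk X n ω) (fun i => ξ i ω) (2 ^ L) :=
    Measurable.comp (g := fun q : (ℕ → ℤ) × (ℤ → ℝ) => diagMajorant k q.1 q.2 (2 ^ L))
      (f := fun ω => (fun n => walk X n ω, fun i => ξ i ω)) (measurable_diagMajorant hk (2 ^ L))
      ((measurable_pi_lambda _ (measurable_walk hXm)).prodMk (measurable_pi_lambda _ hξm))
  have hsum := (summable_geometric_of_lt_one (r := (2 : ℝ) ^ (2 - p - γ)) (by positivity)
    (Real.rpow_lt_one_of_one_lt_of_neg (by norm_num) (by linarith))).mul_left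
    (C * ∫ x, |k x x| ∂ν)
  refine ae_tendsto_zero_of_lintegral_le (fun L => (hm L).const_mul _)
    (fun L ω => mul_nonneg (by positivity) (diagMajorant_nonneg ..)) (fun L => by positivity)
    hsum fun L => ?_
  have hL := lintegral_diagMajorant_le hXm hξm hXξ hν hk hkk (hV (2 ^ L)).1 (hV (2 ^ L)).2
  refine (lintegral_ofReal_const_mul_le (by positivity) (hm L) hL).trans_eq ?_
  refine congrArg ENNReal.ofReal ?_
  have hN : (0 : ℝ) < ((2 ^ L : ℕ) : ℝ) := by positivity
  rw [← natCast_two_pow_rpow, Real.rpow_sub hN _ γ, show 2 - p = 1 + (1 - p) by ring,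
    Real.rpow_add hN, Real.rpow_one]
  field_simp

end AlmostSure

end Rates

theorem proposition2 {Ω : Type*} [MeasurableSpace Ω] (P : Measure Ω) [IsProbabilityMeasure P]
    (α β β' : ℝ) (hα0 : 0 < α) (hα2 : α ≤ 2) (hβ1 : 1 < β) (hβ2 : β ≤ 2) (hβ' : β < β')
    -- the steps of the walk
    (X : ℕ → Ω → ℤ) (hXm : ∀ n, Measurable (X n)) (hXindep : iIndepFun X P)
    (hXid : ∀ n, IdentDistrib (X n) (X 0) P P)
    (hXmean : 1 < α → Integrable (fun ω => (X 0 ω : ℝ)) P ∧ ∫ ω, (X 0 ω : ℝ) ∂P = 0)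
    (Fα : Measure ℝ) [IsProbabilityMeasure Fα] (hFα : IsStableLaw α Fα)
    (hXattr : NormallyAttracted P (fun n ω => (X n ω : ℝ)) α Fα)
    (hXirr : WalkIrreducible P X) (hXaper : WalkStronglyAperiodic P X)
    -- the scenery, independent of the walk
    (ξ : ℤ → Ω → ℝ) (hξm : ∀ i, Measurable (ξ i)) (hξindep : iIndepFun ξ P)
    (hξid : ∀ i, IdentDistrib (ξ i) (ξ 1) P P)
    (hXξ : IndepFun (fun ω n => X n ω) (fun ω i => ξ i ω) P)
    -- the kernel
    (h : ℝ → ℝ → ℝ) (hm : Measurable (Function.uncurry h)) (hsymm : ∀ x y, h x y = h y x)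
    (hint12 : Integrable (fun ω => h (ξ 1 ω) (ξ 2 ω)) P)
    (hint11 : Integrable (fun ω => h (ξ 1 ω) (ξ 1 ω)) P)
    (hmean : ∫ ω, h (ξ 1 ω) (ξ 2 ω) ∂P = 0)
    (hmoment : Integrable (fun ω => |h (ξ 1 ω) (ξ 2 ω)| ^ (2 * β' / (1 + β'))) P)
    (Fβ : Measure ℝ) [IsProbabilityMeasure Fβ] (hFβ : IsStableLaw β Fβ)
    (hξattr : NormallyAttracted P (fun n ω => hoeffding₁ P ξ h (ξ ((n : ℤ) + 1) ω)) β Fβ) :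
    ∀ᵐ ω ∂P,
      (fun n : ℕ => (Finset.range (n + 1)).sup' Finset.nonempty_range_add_one
          (fun k => |hoeffdingRemainder P X ξ h k ω|)) =o[atTop]
        (fun n : ℕ => (n : ℝ) ^ (2 - 1 / max 1 α + 1 / (max 1 α * β))) := by
  have hβ'' : β < min β' 3 := lt_min hβ' (by linarith)
  -- lowering `β'` to at most `3` makes `2 (η - 1) ≤ 1`
  set β'' := min β' 3 with hβ''def
  have hβ''3 : β'' ≤ 3 := min_le_right _ _
  have hβ''le : β'' ≤ β' := min_le_left _ _
  set η := 2 * β'' / (1 + β'') with hη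
  have hη1 : 1 ≤ η := by rw [hη, le_div_iff₀ (by linarith)]; linarith
  have hη2 : η ≤ 3 / 2 := by rw [hη, div_le_div_iff₀ (by linarith) (by norm_num)]; linarith
  have hηle : η ≤ 2 * β' / (1 + β') := by
    rw [hη, div_le_div_iff₀ (by linarith) (by linarith)]; nlinarith
  have hmomentη : Integrable (fun ω => |h (ξ 1 ω) (ξ 2 ω)| ^ η) P :=
    integrable_abs_rpow_of_le (hm.comp ((hξm 1).prodMk (hξm 2))) (by linarith) hηle hmoment
  obtain ⟨hk, hkk⟩ := degenerateKernel_hoeffding₂ hξm hξindep hξid hm hsymm hint12 hint11 hmean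
    hη1 (by linarith) hmomentη
  have hν (i : ℤ) : P.map (ξ i) = P.map (ξ 1) := (hξid i).map_eq
  obtain ⟨p, hp0, hp1, hpα, hpγ, hpe⟩ := exists_exponent hα0 hβ1 hβ'' hη hη2
  generalize 2 - 1 / max 1 α + 1 / (max 1 α * β) = γ at hpγ hpe ⊢
  obtain ⟨C, hC, hV⟩ := exists_integral_selfIntersections_le hXm hXindep hXid hXaper hα0
    hFα.2.1 hXattr hp0 hp1 hpα
  have hη0 : 0 < η := by linarith
  filter_upwards [ae_tendsto_dyadicEnergy hXm hξm hξindep hXξ hν hk hη1 hη2 hC hV hpe,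
    ae_tendsto_diagMajorant hXm hξm hXξ hν hk.measurable hkk hC hV hpγ] with ω h1 h2
  -- back from moments of order `η` to the size of the sums
  have h3 := h1.rpow_const (p := 1 / η) (Or.inr (by positivity))
  rw [Real.zero_rpow (by positivity)] at h3
  have h4 := h3.add h2
  rw [add_zero] at h4
  refine isLittleO_sup'_of_dyadic (by linarith) h4 fun L n hn => ?_
  refine (abs_hoeffdingRemainder_le hn ω).trans ?_
  have hN : (0 : ℝ) < ((2 ^ L : ℕ) : ℝ) := by positivity
  rw [add_mul]
  refine add_le_add ?_ (le_of_eq (by field_simp))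
  have h5 := abs_sum_rpow_le_dyadicEnergy
    (offDiagTerm (hoeffding₂ P ξ h) (fun n => walk X n ω) fun i => ξ i ω) hη1 L 0 (n + 1) hn
  have h6 := Real.rpow_le_rpow (by positivity) h5 (show 0 ≤ 1 / η by positivity)
  rw [← Real.rpow_mul (abs_nonneg _), mul_one_div_cancel hη0.ne', Real.rpow_one] at h6
  refine h6.trans_eq ?_
  have h7 : ((2 ^ L : ℕ) : ℝ) ^ γ = (((2 ^ L : ℕ) : ℝ) ^ (γ * η)) ^ (1 / η) := by
    rw [← Real.rpow_mul hN.le, mul_assoc, mul_one_div_cancel hη0.ne', mul_one]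
  rw [h7, ← Real.mul_rpow (mul_nonneg (by positivity) (dyadicEnergy_nonneg ..)) (by positivity)]
  congr 1
  field_simp
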